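/- **Theorem 1.** Fix a dimension $p$, a set $\Theta\subset\mathbb{R}^p$, a minimal coverage rate $r_0\in(0,1)$ and constants $c_1,\dots,c_5,\rho,\zeta,\Delta_\infty>0$. Let $n\ge 1$, let $\mathbf z_1,\dots,\mathbf z_n$ be independent random elements of a measurable space, and let $\ell(\mathbf z,\theta)$ be a real loss, measurable in $\mathbf z$ for each $\theta\in\Theta$. Let $g(\mathbf z,\theta)=\nabla_\theta\ell(\mathbf z,\theta)$ be its gradient or, more generally, a subgradient on $\Theta$ measurable in $\mathbf z$, that is $\ell(\mathbf z,\theta')\ge\ell(\mathbf z,\theta)+g(\mathbf z,\theta)^\top(\theta'-\theta)$ for all $\theta,\theta'\in\Theta$. An interval is a non-empty set $I=(s,e]\cap\mathbb{Z}$ with integers $0\le s<e\le n$, and $|I|=e-s$. Write $\mathcal L(I,\theta)=\sum_{i\in I}\ell(\mathbf z_i,\theta)$ and $\overline{\mathcal L}(I,\theta)=\mathbb{E}\,\mathcal L(I,\theta)$; let $\widehat\theta_I$ be any minimizer of $\mathcal L(I,\cdot)$ over $\Theta$, let $\theta_I^\circ$ be the minimizer of $\overline{\mathcal L}(I,\cdot)$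 over $\Theta$, $\theta_i^\circ=\theta_{\{i\}}^\circ$, and $\mathbf H_I=|I|^{-1}\nabla^2_\theta\overline{\mathcal L}(I,\theta_I^\circ)$. For a random variable $X$ let $\|X\|_{\Psi_1}=\inf\{t>0:\mathbb{E}\exp(|X|/t)\le 2\}$ ($=\infty$ if there is no such $t$), and for a random vector let $\|\mathbf X\|_{\Psi_1}=\sup_{\|v\|_2=1}\|v^\top\mathbf X\|_{\Psi_1}$. Assume that, for all intervals $I\subset(0,n]$ and all $i\in I$: (a) $\Theta$ is compact and convex, and $\ell(\mathbf z,\cdot)$ is convex on $\Theta$ for every $\mathbf z$; (b) $\mathbb{E}\,\ell(\mathbf z_i,\theta)$ is finite for every $\theta\in\Theta$; (c) $\theta_I^\circ$ exists, is unique, and is an interior point of $\Theta$; (d) $\|g(\mathbf z_i,\theta)\|_{\Psi_1}\le c_1$ for all $\theta$ in some neighbourhood of $\theta_I^\circ$; (e) $\overline{\mathcal L}(I,\cdot)$ is twice differentiable at $\theta_I^\circ$ and $\mathbf H_I$ is positive definite; (f) $\bigl\||I|^{-1}\sum_{j\in I}\mathbb{E}\,g(\mathbf z_j,\theta)-\mathbf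 H_I(\theta-\theta_I^\circ)\bigr\|_2\le c_2\|\theta-\theta_I^\circ\|_2^2$ for $\theta\in\Theta$; (g) $\|g(\mathbf z_i,\theta)-g(\mathbf z_i,\theta_I^\circ)\|_{\Psi_1}\le c_3\|\theta-\theta_I^\circ\|_2$ for $\theta\in\Theta$; (h) $|I|^{-1}\overline{\mathcal L}(I,\cdot)$ is $\rho$-strongly convex on $\Theta$; (i) $\theta\mapsto\mathbb{E}\,g(\mathbf z_i,\theta)$ is $\zeta$-Lipschitz on $\Theta$; (j) $\|\theta_R^\circ-\theta_k^\circ\|_2\le\Delta_\infty$ for all intervals $R\subset I$ with $|R|\ge r_0|I|$ and all $k\in I\setminus R$; (k) $\|\mathbf H_R^{-1}-\mathbf H_I^{-1}\|_{\mathrm{op}}\le c_4\|\theta_R^\circ-\theta_I^\circ\|_2$ for all intervals $R\subset I$ with $|R|\ge r_0|I|$, and $\|\mathbf H_I^{-1}\|_{\mathrm{op}}\le c_5$. Then there are constants $C,K>0$ and, for each real $c$, a constant $C_1(c)>0$, depending only on $p,\Theta,r_0,c_1,\dots,c_5,\rho,\zeta,\Delta_\infty$ (not on $n$, $\ell$,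 $g$ or the distributions), such that there is an event of probability at least $1-n^{-C}$ on which all of the following hold simultaneously for all intervals $R\subset I\subset(0,n]$ and all choices of the minimizers $\widehat\theta_R$, $\widehat\theta_I$. First, $$0\le\frac1{|I|}\{\mathcal L(I,\widehat\theta_R)-\mathcal L(I,\widehat\theta_I)\}.$$ Second, for every coverage rate $r\ge r_0$ such that $|R|\ge r|I|$, $$\frac1{|I|}\{\mathcal L(I,\widehat\theta_R)-\mathcal L(I,\widehat\theta_I)\}\le K\Bigl(\Bigl\|\frac1{|I|}\sum_{i\in I\setminus R}\mathbb{E}\,g(\mathbf z_i,\theta_R^\circ)\Bigr\|_2^2+(1-r)\frac{\log n}{|I|}+\frac{(\log n)^2}{|I|^2}\Bigr).$$ Third, call $\tau\in\{1,\dots,n-1\}$ a changepoint if $\mathbf z_\tau$ and $\mathbf z_{\tau+1}$ have different distributions. If $I=(s,e]$ contains no changepoint, or contains exactly one changepoint $\tau$ and $\min(\tau-s,e-\tau)\le c\log n$, then for every $r\ge r_0$ such that $|R|\ge r|I|$, $$\frac1{|I|}\{\mathcal L(I,\widehat\theta_R)-\mathcal L(I,\widehat\theta_I)\}\le C_1(c)\Bigl((1-r)\frac{\log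 n}{|I|}+\frac{(\log n)^2}{|I|^2}\Bigr).$$ -/

import Mathlib

open MeasureTheory ProbabilityTheory Topology
open scoped ENNReal InnerProductSpace

noncomputable section

/-- The sub-exponential norm `inf {t > 0 : E exp (|X| / t) ≤ 2}` of a real random variable,
with value `∞` when no such `t` exists. -/
def psiOneNorm {Ω : Type*} [MeasurableSpace Ω] (μ : Measure Ω) (X : Ω → ℝ) : ℝ≥0∞ :=
  ⨅ (t : ℝ) (_ : 0 < t) (_ : ∫⁻ ω, ENNReal.ofReal (Real.exp (|X ω| / t)) ∂μ ≤ 2), ENNReal.ofReal t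

/-- The sub-exponential norm of a random vector: the supremum of the sub-exponential norms of its
projections onto unit vectors. -/
def psiOneNormVec {Ω : Type*} [MeasurableSpace Ω] {p : ℕ} (μ : Measure Ω)
    (X : Ω → EuclideanSpace ℝ (Fin p)) : ℝ≥0∞ :=
  ⨆ (v : EuclideanSpace ℝ (Fin p)) (_ : ‖v‖ = 1), psiOneNorm μ (fun ω => ⟪v, X ω⟫_ℝ)

/-- `I` is (the index set of) a non-empty interval `(s, e] ⊆ (0, n]` with integer endpoints. -/
def IsInterval (n : ℕ) (I : Finset ℕ) : Prop :=
  ∃ s e : ℕ, s < e ∧ e ≤ n ∧ I = Finset.Ioc s e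

/-- `R ⊆ I ⊆ (0, n]` are intervals and `R` covers at least the fraction `r` of `I`. -/
def IsCoveredBy (n : ℕ) (r : ℝ) (R I : Finset ℕ) : Prop :=
  IsInterval n R ∧ IsInterval n I ∧ R ⊆ I ∧ r * (I.card : ℝ) ≤ (R.card : ℝ)

/-- The set of minimizers of `f` over `Θ`. -/
def argminSet {E : Type*} (Θ : Set E) (f : E → ℝ) : Set E :=
  {θ | θ ∈ Θ ∧ ∀ θ' ∈ Θ, f θ ≤ f θ'}

section Model

variable {Ω : Type*} [MeasurableSpace Ω] {Z : Type*} {p : ℕ}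

/-- The loss `L(I, θ) = ∑_{i ∈ I} ℓ(z_i, θ)` at the outcome `ω`. -/
def empLoss (z : ℕ → Ω → Z) (ℓ : Z → EuclideanSpace ℝ (Fin p) → ℝ) (ω : Ω) (I : Finset ℕ)
    (θ : EuclideanSpace ℝ (Fin p)) : ℝ :=
  ∑ i ∈ I, ℓ (z i ω) θ

/-- The expected loss `∑_{i ∈ I} E ℓ(z_i, θ)`. -/
def popLoss (μ : Measure Ω) (z : ℕ → Ω → Z) (ℓ : Z → EuclideanSpace ℝ (Fin p) → ℝ) (I : Finset ℕ)
    (θ : EuclideanSpace ℝ (Fin p)) : ℝ :=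
  ∑ i ∈ I, ∫ ω, ℓ (z i ω) θ ∂μ

/-- `E G_I(α)`, where `G_I(α) = |I|⁻¹ ∑_{i ∈ I} g(z_i, θ₀ + |I|^{-1/2} α)`. -/
def popScore (μ : Measure Ω) (z : ℕ → Ω → Z)
    (g : Z → EuclideanSpace ℝ (Fin p) → EuclideanSpace ℝ (Fin p)) (I : Finset ℕ)
    (θ₀ α : EuclideanSpace ℝ (Fin p)) : EuclideanSpace ℝ (Fin p) :=
  (I.card : ℝ)⁻¹ • ∑ i ∈ I, ∫ ω, g (z i ω) (θ₀ + (√(I.card : ℝ))⁻¹ • α) ∂μ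

/-- The normalized Hessian `|I|⁻¹ ∇² E L(I, θ)`, as a linear operator. -/
def popHessian (μ : Measure Ω) (z : ℕ → Ω → Z) (ℓ : Z → EuclideanSpace ℝ (Fin p) → ℝ)
    (I : Finset ℕ) (θ : EuclideanSpace ℝ (Fin p)) :
    EuclideanSpace ℝ (Fin p) →L[ℝ] EuclideanSpace ℝ (Fin p) :=
  (I.card : ℝ)⁻¹ • fderiv ℝ (gradient (popLoss μ z ℓ I)) θ

/-- The squared bias `‖ |I|⁻¹ ∑_{i ∈ I \ R} E g(z_i, θ) ‖²`. -/
def biasSq (μ : Measure Ω) (z : ℕ → Ω → Z)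
    (g : Z → EuclideanSpace ℝ (Fin p) → EuclideanSpace ℝ (Fin p)) (I R : Finset ℕ)
    (θ : EuclideanSpace ℝ (Fin p)) : ℝ :=
  ‖(I.card : ℝ)⁻¹ • ∑ i ∈ I \ R, ∫ ω, g (z i ω) θ ∂μ‖ ^ 2

/-- `τ` is a changepoint of the sequence `z₁, …, z_n`: the law changes from `z_τ` to `z_{τ+1}`. -/
def IsChangepoint [MeasurableSpace Z] (μ : Measure Ω) (z : ℕ → Ω → Z) (n τ : ℕ) : Prop :=
  0 < τ ∧ τ < n ∧ μ.map (z τ) ≠ μ.map (z (τ + 1))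

/-- `I = (s, e]` contains no changepoint, or it contains exactly one changepoint `τ`, and
`min (τ - s) (e - τ) ≤ c log n`. -/
def NearlyHomogeneous [MeasurableSpace Z] (μ : Measure Ω) (z : ℕ → Ω → Z) (n : ℕ) (c : ℝ)
    (I : Finset ℕ) : Prop :=
  ∃ s e : ℕ, s < e ∧ I = Finset.Ioc s e ∧
    ((∀ τ ∈ I, ¬ IsChangepoint μ z n τ) ∨
      ∃ τ ∈ I, IsChangepoint μ z n τ ∧ (∀ τ' ∈ I, IsChangepoint μ z n τ' → τ' = τ) ∧
        min ((τ : ℝ) - s) ((e : ℝ) - τ) ≤ c * Real.log n)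

/-- The observations `z₁, …, z_n` are independent random elements, and the regularity conditions
of convex M-estimation hold for the loss `ℓ`, its (sub-)gradient `g` in the parameter, the parameter
set `Θ`, and the population minimizers `θ₀ I`. -/
structure MEstConditions [MeasurableSpace Z] (Θ : Set (EuclideanSpace ℝ (Fin p)))
    (r₀ c₁ c₂ c₃ c₄ c₅ ρ ζ Δ : ℝ) (n : ℕ) (μ : Measure Ω) (z : ℕ → Ω → Z)
    (ℓ : Z → EuclideanSpace ℝ (Fin p) → ℝ)
    (g : Z → EuclideanSpace ℝ (Fin p) → EuclideanSpace ℝ (Fin p))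
    (θ₀ : Finset ℕ → EuclideanSpace ℝ (Fin p)) : Prop where
  measurable_obs : ∀ i ∈ Finset.Ioc 0 n, Measurable (z i)
  indep_obs : iIndepFun (fun i : Finset.Ioc 0 n => z i) μ
  measurable_loss : ∀ θ ∈ Θ, Measurable (fun x => ℓ x θ)
  measurable_grad : ∀ θ ∈ Θ, Measurable (fun x => g x θ)
  /-- `g(x, θ)` is a subgradient of `ℓ(x, ·)` at `θ` (the gradient, if there is one and `θ` is an
  interior point). -/
  subgradient : ∀ x, ∀ θ ∈ Θ, ∀ θ' ∈ Θ, ℓ x θ + ⟪g x θ, θ' - θ⟫_ℝ ≤ ℓ x θ'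
  compact : IsCompact Θ
  convex : Convex ℝ Θ
  convex_loss : ∀ x, ConvexOn ℝ Θ (ℓ x)
  integrable_loss : ∀ i ∈ Finset.Ioc 0 n, ∀ θ ∈ Θ, Integrable (fun ω => ℓ (z i ω) θ) μ
  /-- The unique population minimizer. -/
  argmin_pop : ∀ I, IsInterval n I → argminSet Θ (popLoss μ z ℓ I) = {θ₀ I}
  interior_pop : ∀ I, IsInterval n I → θ₀ I ∈ interior Θ
  subexp_grad : ∀ I, IsInterval n I → ∀ᶠ θ in 𝓝 (θ₀ I), ∀ i ∈ I,
    psiOneNormVec μ (fun ω => g (z i ω) θ) ≤ ENNReal.ofReal c₁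
  /-- Twice differentiability at the population minimizer. -/
  diff_pop : ∀ I, IsInterval n I → (∀ᶠ θ in 𝓝 (θ₀ I), DifferentiableAt ℝ (popLoss μ z ℓ I) θ) ∧
    DifferentiableAt ℝ (gradient (popLoss μ z ℓ I)) (θ₀ I)
  posDef_hessian : ∀ I, IsInterval n I → ∀ v : EuclideanSpace ℝ (Fin p), v ≠ 0 →
    0 < ⟪v, popHessian μ z ℓ I (θ₀ I) v⟫_ℝ
  expansion : ∀ I, IsInterval n I → ∀ θ ∈ Θ,
    ‖popScore μ z g I (θ₀ I) (√(I.card : ℝ) • (θ - θ₀ I))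
      - popHessian μ z ℓ I (θ₀ I) (θ - θ₀ I)‖ ≤ c₂ * ‖θ - θ₀ I‖ ^ 2
  subexp_increment : ∀ I, IsInterval n I → ∀ i ∈ I, ∀ θ ∈ Θ,
    psiOneNormVec μ (fun ω => g (z i ω) θ - g (z i ω) (θ₀ I)) ≤ ENNReal.ofReal (c₃ * ‖θ - θ₀ I‖)
  strongConvex : ∀ I, IsInterval n I →
    StrongConvexOn Θ ρ (fun θ => (I.card : ℝ)⁻¹ * popLoss μ z ℓ I θ)
  lipschitz_grad : ∀ i ∈ Finset.Ioc 0 n, ∀ θ ∈ Θ, ∀ θ' ∈ Θ,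
    ‖∫ ω, g (z i ω) θ ∂μ - ∫ ω, g (z i ω) θ' ∂μ‖ ≤ ζ * ‖θ - θ'‖
  bounded_change : ∀ R I, IsCoveredBy n r₀ R I → ∀ i ∈ I \ R, ‖θ₀ R - θ₀ {i}‖ ≤ Δ
  hessian_inv_lipschitz : ∀ R I, IsCoveredBy n r₀ R I →
    ‖(popHessian μ z ℓ R (θ₀ R)).inverse - (popHessian μ z ℓ I (θ₀ I)).inverse‖
      ≤ c₄ * ‖θ₀ R - θ₀ I‖
  hessian_inv_bounded : ∀ I, IsInterval n I → ‖(popHessian μ z ℓ I (θ₀ I)).inverse‖ ≤ c₅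

end Model

end

/-! ### Sub-exponential random variables -/

/-! Write x and y for minimizers of the empirical loss over R and over I, u = log n / |I|, κ = |I \
R| / |I|, and b for the norm of the bias. The excess loss of x over I is squeezed between two
inequalities in e = ‖x - y‖, both valid on one event.

From above (`excess_le`): x is optimal on R, so only the indices in I \ R contribute. Their centred
loss has Lipschitz constant of order √(κu) + u after division by |I|. Their mean loss has slope at
most b plus a multiple of κ‖x - θ₀ R‖. Hence the excess is at most a constant times G(e + 1/n),
where G = b + √(κu) + u.

From below (`le_excess`): strong convexity of the mean loss is compared with the empirical loss at
the midpoint of x and y. In this second difference the linear part of the noise, the score at θ₀ I,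
cancels. What is left is the noise of score increments, which is proportional to the distance from
θ₀ I, itself of order √u + u + b. Their product is of order b + u, with no √u term, and e² is
bounded by the excess plus a multiple of (b + u)(e + 1/n).

Together these force e to be of order G, so the excess is of order G², that is b² + κu + u²
(`excess_le_sq`).

The event (`exists_measurableSet_empiricalControl`) comes from Bernstein's inequality and a union
bound over intervals and a net of mesh n⁻³. The subgradient may be discontinuous in θ, so only
losses, never subgradients, are transported off the net: convexity turns bounds on subgradients at
net points into increments of the loss (`empNoise_sub_le`), and chaining through ever finer nets
reaches arbitrary points of Θ (`abs_sub_le_of_chaining`).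

Over nearly homogeneous intervals the bias is of order u: the mean scores at θ₀ R sum to zero over R
and agree outside a set of O(log n) indices (`norm_sum_le_of_eq_on_majority`). -/

theorem Real.exp_le_one_add_add_sq_mul_exp_abs (x : ℝ) :
    Real.exp x ≤ 1 + x + x ^ 2 * Real.exp |x| := by
  have h1 : 1 ≤ Real.exp |x| := Real.one_le_exp (abs_nonneg x)
  have h2 : x ^ 2 ≤ x ^ 2 * Real.exp |x| := le_mul_of_one_le_right (sq_nonneg x) h1
  rcases le_total |x| 1 with h | h
  · have := le_of_abs_le (Real.abs_exp_sub_one_sub_id_le h)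
    linarith
  · rcases le_total 0 x with hx | hx
    · rw [abs_of_nonneg hx] at h ⊢
      have : Real.exp x ≤ x ^ 2 * Real.exp x :=
        le_mul_of_one_le_left (Real.exp_pos x).le (by nlinarith)
      linarith
    · rw [abs_of_nonpos hx] at h
      have : Real.exp x ≤ 1 := Real.exp_le_one_iff.2 hx
      nlinarith

section SubExponential

variable {Ω : Type*} [MeasurableSpace Ω] {μ : Measure Ω}

/-- Admissible scales are closed upwards. The strict inequality produces an admissible scale below b
without asking whether the infimum is attained; this is why later scales carry some slack. -/
theorem lintegral_exp_abs_div_le_of_psiOneNorm_lt {X : Ω → ℝ} {b : ℝ}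
    (h : psiOneNorm μ X < ENNReal.ofReal b) :
    ∫⁻ ω, ENNReal.ofReal (Real.exp (|X ω| / b)) ∂μ ≤ 2 := by
  simp only [psiOneNorm, iInf_lt_iff] at h
  obtain ⟨t, ht, h2, htb⟩ := h
  refine le_trans (lintegral_mono fun ω => ?_) h2
  have htb' : t ≤ b := by
    by_contra hcon
    exact absurd htb (not_lt.2 (ENNReal.ofReal_le_ofReal (not_le.1 hcon).le))
  gcongr

/-- Convexity of exp at the average of |X|/a and |Y|/a; no independence is needed. -/
theorem lintegral_exp_abs_add_div_le {X Y : Ω → ℝ} {a : ℝ} (hX : Measurable X)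
    (h1 : ∫⁻ ω, ENNReal.ofReal (Real.exp (|X ω| / a)) ∂μ ≤ 2)
    (h2 : ∫⁻ ω, ENNReal.ofReal (Real.exp (|Y ω| / a)) ∂μ ≤ 2) (ha : 0 < a) :
    ∫⁻ ω, ENNReal.ofReal (Real.exp (|X ω + Y ω| / (2 * a))) ∂μ ≤ 2 := by
  have key : ∀ x y : ℝ, ENNReal.ofReal (Real.exp (|x + y| / (2 * a))) ≤
      ENNReal.ofReal (1 / 2) * ENNReal.ofReal (Real.exp (|x| / a)) +
        ENNReal.ofReal (1 / 2) * ENNReal.ofReal (Real.exp (|y| / a)) := by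
    intro x y
    rw [← ENNReal.ofReal_mul (by norm_num), ← ENNReal.ofReal_mul (by norm_num),
      ← ENNReal.ofReal_add (by positivity) (by positivity)]
    apply ENNReal.ofReal_le_ofReal
    have hc := convexOn_exp.2 (Set.mem_univ (|x| / a)) (Set.mem_univ (|y| / a))
      (by norm_num : (0 : ℝ) ≤ 1 / 2) (by norm_num : (0 : ℝ) ≤ 1 / 2) (by norm_num)
    simp only [smul_eq_mul] at hc
    refine le_trans (Real.exp_le_exp.2 ?_) hc
    have := abs_add_le x y
    calc |x + y| / (2 * a) ≤ (|x| + |y|) / (2 * a) := by gcongr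
      _ = _ := by field_simp
  calc ∫⁻ ω, ENNReal.ofReal (Real.exp (|X ω + Y ω| / (2 * a))) ∂μ
      ≤ ∫⁻ ω, (ENNReal.ofReal (1 / 2) * ENNReal.ofReal (Real.exp (|X ω| / a)) +
        ENNReal.ofReal (1 / 2) * ENNReal.ofReal (Real.exp (|Y ω| / a))) ∂μ :=
        lintegral_mono fun ω => key _ _
    _ ≤ ENNReal.ofReal (1 / 2) * 2 + ENNReal.ofReal (1 / 2) * 2 := by
        rw [lintegral_add_left (by fun_prop), lintegral_const_mul' _ _ (by simp),
          lintegral_const_mul' _ _ (by simp)]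
        gcongr
    _ = 2 := by
        rw [← ENNReal.ofReal_ofNat 2, ← ENNReal.ofReal_mul (by norm_num),
          ← ENNReal.ofReal_add (by norm_num) (by norm_num)]
        norm_num

variable {X : Ω → ℝ} {b : ℝ}

theorem integrable_exp_abs_div (hX : Measurable X)
    (h : ∫⁻ ω, ENNReal.ofReal (Real.exp (|X ω| / b)) ∂μ ≤ 2) :
    Integrable (fun ω => Real.exp (|X ω| / b)) μ ∧ ∫ ω, Real.exp (|X ω| / b) ∂μ ≤ 2 := by
  have hm : AEStronglyMeasurable (fun ω => Real.exp (|X ω| / b)) μ :=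
    (by fun_prop : Measurable fun ω => Real.exp (|X ω| / b)).aestronglyMeasurable
  have hp : 0 ≤ᵐ[μ] fun ω => Real.exp (|X ω| / b) := ae_of_all _ fun ω => (Real.exp_pos _).le
  have hi : Integrable (fun ω => Real.exp (|X ω| / b)) μ :=
    (lintegral_ofReal_ne_top_iff_integrable hm hp).1 (h.trans_lt (by simp)).ne
  refine ⟨hi, ?_⟩
  rw [integral_eq_lintegral_of_nonneg_ae hp hm]
  exact ENNReal.toReal_le_of_le_ofReal (by norm_num) (by simpa using h)

theorem integrable_of_lintegral_exp_abs_div_le (hX : Measurable X) (hb : 0 < b)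
    (h : ∫⁻ ω, ENNReal.ofReal (Real.exp (|X ω| / b)) ∂μ ≤ 2) :
    Integrable X μ ∧ ∫ ω, |X ω| ∂μ ≤ 2 * b := by
  obtain ⟨hi, h2⟩ := integrable_exp_abs_div hX h
  have hle : ∀ ω, |X ω| ≤ b * Real.exp (|X ω| / b) := fun ω => by
    have := Real.add_one_le_exp (|X ω| / b)
    calc |X ω| = b * (|X ω| / b) := by field_simp
      _ ≤ _ := by gcongr; linarith
  have hiX : Integrable X μ := (hi.const_mul b).mono' hX.aestronglyMeasurable
    (ae_of_all _ hle)
  refine ⟨hiX, ?_⟩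
  calc ∫ ω, |X ω| ∂μ ≤ ∫ ω, b * Real.exp (|X ω| / b) ∂μ :=
        integral_mono hiX.abs (hi.const_mul b) hle
    _ ≤ 2 * b := by rw [integral_const_mul]; nlinarith

theorem mgf_centered_le [IsProbabilityMeasure μ] (hX : Measurable X) (hb : 0 < b)
    (h : ∫⁻ ω, ENNReal.ofReal (Real.exp (|X ω| / b)) ∂μ ≤ 2) {s : ℝ} (hs : |s| ≤ 1 / (2 * b)) :
    Integrable (fun ω => Real.exp (s * (X ω - ∫ ω', X ω' ∂μ))) μ ∧
      mgf (fun ω => X ω - ∫ ω', X ω' ∂μ) μ s ≤ Real.exp (16 * s ^ 2 * b ^ 2) := by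
  obtain ⟨hi, h2⟩ := integrable_exp_abs_div hX h
  obtain ⟨hiX, -⟩ := integrable_of_lintegral_exp_abs_div_le hX hb h
  -- With y = |x|/b, the bound on s leaves room: one factor exp(y/2) absorbs y² and the other
  -- absorbs exp|sx|.
  have hle : ∀ x : ℝ, Real.exp (s * x) ≤
      1 + s * x + 8 * s ^ 2 * b ^ 2 * Real.exp (|x| / b) := by
    intro x
    have h0 := Real.exp_le_one_add_add_sq_mul_exp_abs (s * x)
    set y := |x| / b with hy
    have hy0 : 0 ≤ y := by positivity
    have hxy : x ^ 2 = b ^ 2 * y ^ 2 := by rw [hy, div_pow, sq_abs]; field_simp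
    have h3 : |s * x| ≤ y / 2 := by
      rw [abs_mul]
      calc |s| * |x| ≤ 1 / (2 * b) * |x| := by gcongr
        _ = y / 2 := by rw [hy]; field_simp
    have h4 : y ^ 2 ≤ 8 * Real.exp (y / 2) := by
      have := Real.quadratic_le_exp_of_nonneg (by positivity : 0 ≤ y / 2)
      nlinarith
    have h5 : (s * x) ^ 2 * Real.exp |s * x| ≤ 8 * s ^ 2 * b ^ 2 * Real.exp y := by
      calc (s * x) ^ 2 * Real.exp |s * x| = s ^ 2 * b ^ 2 * (y ^ 2 * Real.exp |s * x|) := by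
            rw [mul_pow, hxy]; ring
        _ ≤ s ^ 2 * b ^ 2 * (8 * Real.exp (y / 2) * Real.exp (y / 2)) := by gcongr
        _ = _ := by rw [mul_assoc 8, ← Real.exp_add, add_halves]; ring
    linarith
  set m := ∫ ω', X ω' ∂μ with hm
  have hint : Integrable (fun ω => 1 + s * X ω + 8 * s ^ 2 * b ^ 2 * Real.exp (|X ω| / b)) μ :=
    ((integrable_const _).add (hiX.const_mul s)).add (hi.const_mul _)
  have hexp : Integrable (fun ω => Real.exp (s * X ω)) μ :=
    hint.mono' (by fun_prop) (ae_of_all _ fun ω => by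
      rw [Real.norm_eq_abs, Real.abs_exp]; exact hle _)
  have hfac : ∀ ω, Real.exp (s * (X ω - m)) = Real.exp (-(s * m)) * Real.exp (s * X ω) := fun ω => by
    rw [← Real.exp_add]; ring_nf
  constructor
  · simp_rw [hfac]
    exact hexp.const_mul _
  · have hbd : ∫ ω, Real.exp (s * X ω) ∂μ ≤ 1 + s * m + 16 * s ^ 2 * b ^ 2 := by
      calc ∫ ω, Real.exp (s * X ω) ∂μ
          ≤ ∫ ω, (1 + s * X ω + 8 * s ^ 2 * b ^ 2 * Real.exp (|X ω| / b)) ∂μ :=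
            integral_mono hexp hint fun ω => hle _
        _ = 1 + s * m + 8 * s ^ 2 * b ^ 2 * ∫ ω, Real.exp (|X ω| / b) ∂μ := by
            have i1 : Integrable (fun ω => 1 + s * X ω) μ :=
              (integrable_const _).add (hiX.const_mul s)
            rw [integral_add i1 (hi.const_mul _), integral_add (integrable_const _) (hiX.const_mul s),
              integral_const_mul, integral_const_mul]
            simp [hm]
        _ ≤ _ := by nlinarith [mul_nonneg (sq_nonneg s) (sq_nonneg b)]
    rw [mgf]
    simp_rw [hfac]
    rw [integral_const_mul]
    calc Real.exp (-(s * m)) * ∫ ω, Real.exp (s * X ω) ∂μ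
        ≤ Real.exp (-(s * m)) * Real.exp (s * m + 16 * s ^ 2 * b ^ 2) := by
          gcongr
          refine hbd.trans ?_
          have := Real.add_one_le_exp (s * m + 16 * s ^ 2 * b ^ 2)
          linarith
      _ = _ := by rw [← Real.exp_add]; ring_nf

theorem measure_le_abs_of_lintegral_exp_abs_div_le (hX : Measurable X) (hb : 0 < b)
    (h : ∫⁻ ω, ENNReal.ofReal (Real.exp (|X ω| / b)) ∂μ ≤ 2) (t : ℝ) :
    μ {ω | b * t ≤ |X ω|} ≤ ENNReal.ofReal (2 * Real.exp (-t)) := by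
  have h1 := mul_meas_ge_le_lintegral₀ (μ := μ)
    (f := fun ω => ENNReal.ofReal (Real.exp (|X ω| / b))) (by fun_prop)
    (ENNReal.ofReal (Real.exp t))
  have h2 : {ω | b * t ≤ |X ω|} ⊆
      {ω | ENNReal.ofReal (Real.exp t) ≤ ENNReal.ofReal (Real.exp (|X ω| / b))} := by
    intro ω hω
    apply ENNReal.ofReal_le_ofReal
    apply Real.exp_le_exp.2
    rw [le_div_iff₀ hb, mul_comm]
    exact hω
  have h3 : ENNReal.ofReal (Real.exp t) * μ {ω | b * t ≤ |X ω|} ≤ 2 :=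
    le_trans (by gcongr) (h1.trans h)
  have h4 : ENNReal.ofReal (2 * Real.exp (-t)) = ENNReal.ofReal (Real.exp (-t)) * 2 := by
    rw [mul_comm, ENNReal.ofReal_mul (Real.exp_pos _).le]; simp
  have h5 : ENNReal.ofReal (Real.exp (-t)) * ENNReal.ofReal (Real.exp t) = 1 := by
    rw [← ENNReal.ofReal_mul (Real.exp_pos _).le, ← Real.exp_add]; simp
  rw [h4]
  calc μ {ω | b * t ≤ |X ω|}
      = ENNReal.ofReal (Real.exp (-t)) * (ENNReal.ofReal (Real.exp t) * μ {ω | b * t ≤ |X ω|}) := by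
        rw [← mul_assoc, h5, one_mul]
    _ ≤ _ := by gcongr

/-- One-sided Bernstein inequality, for centred variables with the given bound on the
moment generating functions. -/
theorem measure_le_sum_of_mgf_le [IsProbabilityMeasure μ] {ι : Type*} [Fintype ι]
    {Y : ι → Ω → ℝ} (hind : iIndepFun Y μ) (hY : ∀ i, Measurable (Y i)) (hb : 0 < b)
    (h : ∀ i s, |s| ≤ 1 / (2 * b) → Integrable (fun ω => Real.exp (s * Y i ω)) μ ∧
      mgf (Y i) μ s ≤ Real.exp (16 * s ^ 2 * b ^ 2)) {t : ℝ} (ht : 0 < t) :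
    μ {ω | b * (34 * (√(Fintype.card ι * t) + t)) ≤ ∑ i, Y i ω} ≤
      ENNReal.ofReal (Real.exp (-t)) := by
  set N : ℝ := (Fintype.card ι : ℝ) with hN
  have hN0 : 0 ≤ N := by positivity
  obtain ⟨s, hs0, hs, hst⟩ : ∃ s : ℝ, 0 ≤ s ∧ s ≤ 1 / (2 * b) ∧
      -s * (b * (34 * (√(N * t) + t))) + N * (16 * s ^ 2 * b ^ 2) ≤ -t := by
    -- The Chernoff parameter √(t/N)/b is used while it is at most 1/(2b), and 1/(2b) beyond. The
    -- constant 34 is what the second regime needs: -17t + 4N ≤ -t when N ≤ 4t.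
    rcases le_total t (N / 4) with hc | hc
    · have hNpos : 0 < N := by linarith
      refine ⟨√(t / N) / b, by positivity, ?_, ?_⟩
      · rw [div_le_div_iff₀ hb (by positivity)]
        have : √(t / N) ≤ 1 / 2 := by
          apply Real.sqrt_le_iff.2 ⟨by norm_num, ?_⟩
          rw [div_le_iff₀ hNpos]; linarith
        nlinarith
      · have e1 : √(t / N) * √(N * t) = t := by
          rw [← Real.sqrt_mul (by positivity), show t / N * (N * t) = t ^ 2 by field_simp,
            Real.sqrt_sq ht.le]
        have e2 : √(t / N) ^ 2 = t / N := Real.sq_sqrt (by positivity)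
        have e3 : -(√(t / N) / b) * (b * (34 * (√(N * t) + t))) +
            N * (16 * (√(t / N) / b) ^ 2 * b ^ 2) =
            -34 * (√(t / N) * √(N * t)) - 34 * (√(t / N) * t) + 16 * N * √(t / N) ^ 2 := by
          field_simp
          ring
        have e4 : 16 * N * (t / N) = 16 * t := by field_simp
        rw [e3, e1, e2, e4]
        have : 0 ≤ √(t / N) * t := by positivity
        linarith
    · refine ⟨1 / (2 * b), by positivity, le_rfl, ?_⟩
      have e3 : -(1 / (2 * b)) * (b * (34 * (√(N * t) + t))) +
          N * (16 * (1 / (2 * b)) ^ 2 * b ^ 2) = -17 * √(N * t) - 17 * t + 4 * N := by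
        field_simp
        ring
      rw [e3]
      have : 0 ≤ √(N * t) := Real.sqrt_nonneg _
      linarith
  have hs' : |s| ≤ 1 / (2 * b) := by rwa [abs_of_nonneg hs0]
  have hint := hind.integrable_exp_mul_sum hY (s := Finset.univ) (t := s)
    fun i _ => (h i s hs').1
  have h1 := measure_ge_le_exp_mul_mgf (μ := μ) (b * (34 * (√(N * t) + t))) hs0 hint
  rw [hind.mgf_sum hY] at h1
  have h2 : ∏ i : ι, mgf (Y i) μ s ≤ Real.exp (N * (16 * s ^ 2 * b ^ 2)) := by
    calc ∏ i : ι, mgf (Y i) μ s ≤ ∏ _i : ι, Real.exp (16 * s ^ 2 * b ^ 2) :=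
          Finset.prod_le_prod (fun i _ => mgf_nonneg) fun i _ => (h i s hs').2
      _ = _ := by rw [Finset.prod_const, ← Real.exp_nat_mul, Finset.card_univ]
  have h3 : μ.real {ω | b * (34 * (√(N * t) + t)) ≤ (∑ i, Y i) ω} ≤ Real.exp (-t) := by
    refine h1.trans ?_
    calc _ ≤ Real.exp (-s * (b * (34 * (√(N * t) + t)))) * Real.exp (N * (16 * s ^ 2 * b ^ 2)) := by
          gcongr
      _ ≤ _ := by rw [← Real.exp_add]; exact Real.exp_le_exp.2 hst
  rw [← ENNReal.ofReal_toReal (measure_ne_top μ _)]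
  apply ENNReal.ofReal_le_ofReal
  simpa only [Finset.sum_apply, Measure.real] using h3

/-- Bernstein's inequality for independent sub-exponential random variables. -/
theorem measure_le_abs_sum_centered [IsProbabilityMeasure μ] {ι : Type*} [Fintype ι]
    {Y : ι → Ω → ℝ} (hind : iIndepFun Y μ) (hY : ∀ i, Measurable (Y i)) (hb : 0 < b)
    (h : ∀ i, ∫⁻ ω, ENNReal.ofReal (Real.exp (|Y i ω| / b)) ∂μ ≤ 2) {t : ℝ} (ht : 0 < t) :
    μ {ω | b * (34 * (√(Fintype.card ι * t) + t)) ≤ |∑ i, (Y i ω - ∫ ω', Y i ω' ∂μ)|} ≤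
      ENNReal.ofReal (2 * Real.exp (-t)) := by
  have hup := measure_le_sum_of_mgf_le (Y := fun i ω => Y i ω - ∫ ω', Y i ω' ∂μ)
    (hind.comp (fun i x => x - ∫ ω', Y i ω' ∂μ) fun i => by fun_prop)
    (fun i => by fun_prop) hb (fun i s hs => mgf_centered_le (hY i) hb (h i) hs) ht
  have hlow := measure_le_sum_of_mgf_le (Y := fun i ω => -(Y i ω - ∫ ω', Y i ω' ∂μ))
    (hind.comp (fun i x => -(x - ∫ ω', Y i ω' ∂μ)) fun i => by fun_prop)
    (fun i => by fun_prop) hb (fun i s hs => by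
      have := mgf_centered_le (hY i) hb (h i) (s := -s) (by rwa [abs_neg])
      rw [neg_sq] at this
      refine ⟨by simpa only [neg_mul, mul_neg] using this.1, ?_⟩
      have e := mgf_neg (X := fun ω => Y i ω - ∫ ω', Y i ω' ∂μ) (μ := μ) (t := s)
      exact (le_of_eq e).trans this.2) ht
  have hsub : {ω | b * (34 * (√(Fintype.card ι * t) + t)) ≤ |∑ i, (Y i ω - ∫ ω', Y i ω' ∂μ)|} ⊆
      {ω | b * (34 * (√(Fintype.card ι * t) + t)) ≤ ∑ i, (Y i ω - ∫ ω', Y i ω' ∂μ)} ∪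
      {ω | b * (34 * (√(Fintype.card ι * t) + t)) ≤ ∑ i, -(Y i ω - ∫ ω', Y i ω' ∂μ)} := by
    intro ω hω
    rw [Set.mem_ofPred_eq, le_abs] at hω
    rcases hω with h' | h'
    · exact Or.inl h'
    · right
      simpa only [Set.mem_ofPred_eq, Finset.sum_neg_distrib] using h'
  calc _ ≤ _ := measure_mono hsub
    _ ≤ _ := measure_union_le _ _
    _ ≤ ENNReal.ofReal (Real.exp (-t)) + ENNReal.ofReal (Real.exp (-t)) := add_le_add hup hlow
    _ = _ := by rw [← ENNReal.ofReal_add (Real.exp_pos _).le (Real.exp_pos _).le, two_mul]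

end SubExponential

/-! ### Finite nets of bounded sets -/

theorem EuclideanSpace.norm_le_sum_abs {p : ℕ} (v : EuclideanSpace ℝ (Fin p)) :
    ‖v‖ ≤ ∑ j, |v j| := by
  rw [EuclideanSpace.norm_eq]
  apply Real.sqrt_le_iff.2 ⟨Finset.sum_nonneg fun _ _ => abs_nonneg _, ?_⟩
  exact Finset.sum_sq_le_sq_sum_of_nonneg fun _ _ => norm_nonneg _

theorem exists_finset_net {p : ℕ} {Θ : Set (EuclideanSpace ℝ (Fin p))}
    (hΘ : Bornology.IsBounded Θ) :
    ∃ b : ℕ, ∀ n : ℕ, 2 ≤ n → ∀ m : ℕ, ∃ N : Finset (EuclideanSpace ℝ (Fin p)),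
      (∀ q ∈ N, q ∈ Θ) ∧ (∀ x ∈ Θ, ∃ q ∈ N, ‖x - q‖ ≤ ((n : ℝ) ^ m)⁻¹) ∧
        N.card ≤ n ^ (b * (m + 1)) := by
  classical
  obtain ⟨B, hB⟩ := hΘ.exists_norm_le
  obtain ⟨D, hD⟩ := exists_nat_ge B
  -- The exponent must not depend on n or m. The numerical prefactor a = 3(D+1)(p+1) is absorbed
  -- through a ≤ n^a, valid since n ≥ 2.
  refine ⟨(3 * (D + 1) * (p + 1)) * p + p, fun n hn m => ?_⟩
  set M : ℕ := (p + 1) * n ^ m with hM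
  have hM0 : 0 < M := by positivity
  set f : EuclideanSpace ℝ (Fin p) → Fin p → ℤ := fun x j => ⌊x j * M⌋ with hf
  set K : ℤ := (D + 1) * M with hK
  set T : Finset (Fin p → ℤ) := Fintype.piFinset fun _ => Finset.Ico (-K) K with hT
  have hfT : ∀ x ∈ Θ, f x ∈ T := by
    intro x hx
    rw [hT, Fintype.mem_piFinset]
    intro j
    have h1 : |x j| ≤ D := ((PiLp.norm_apply_le x j).trans (hB x hx)).trans hD
    obtain ⟨h2, h3⟩ := abs_le.1 h1
    have hMr : (0 : ℝ) < M := by exact_mod_cast hM0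
    rw [Finset.mem_Ico, Int.le_floor, Int.floor_lt, hK]
    push_cast
    constructor <;> nlinarith
  -- One point of Θ is picked in each grid cell meeting Θ: net points must lie in Θ, where the
  -- subgradient inequality is available.
  have hrep : ∀ v ∈ T.filter (fun v => ∃ x ∈ Θ, f x = v), ∃ x ∈ Θ, f x = v :=
    fun v hv => (Finset.mem_filter.1 hv).2
  choose! r hr using hrep
  refine ⟨(T.filter fun v => ∃ x ∈ Θ, f x = v).image r, ?_, ?_, ?_⟩
  · intro q hq
    obtain ⟨v, hv, rfl⟩ := Finset.mem_image.1 hq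
    exact (hr v hv).1
  · intro x hx
    have hv : f x ∈ T.filter fun v => ∃ x ∈ Θ, f x = v :=
      Finset.mem_filter.2 ⟨hfT x hx, x, hx, rfl⟩
    refine ⟨r (f x), Finset.mem_image_of_mem _ hv, ?_⟩
    have he := (hr _ hv).2
    have hj : ∀ j, |(x - r (f x)) j| ≤ (M : ℝ)⁻¹ := by
      intro j
      have hMr : (0 : ℝ) < M := by exact_mod_cast hM0
      have h1 : ⌊r (f x) j * M⌋ = ⌊x j * M⌋ := congrFun he j
      have h2 := Int.abs_sub_lt_one_of_floor_eq_floor h1.symm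
      rw [← sub_mul, abs_mul, abs_of_pos hMr] at h2
      rw [← one_div, le_div_iff₀ hMr]
      exact h2.le
    refine (EuclideanSpace.norm_le_sum_abs _).trans ?_
    calc ∑ j, |(x - r (f x)) j| ≤ ∑ _j : Fin p, (M : ℝ)⁻¹ := Finset.sum_le_sum fun j _ => hj j
      _ = p * (M : ℝ)⁻¹ := by simp
      _ ≤ _ := by
        rw [hM]
        push_cast
        rw [mul_inv, ← mul_assoc]
        apply mul_le_of_le_one_left (by positivity)
        rw [← div_eq_mul_inv, div_le_one (by positivity)]
        linarith
  · refine Finset.card_image_le.trans ((Finset.card_filter_le _ _).trans ?_)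
    rw [hT, Fintype.card_piFinset]
    simp only [Int.card_Ico, Finset.prod_const, Finset.card_univ, Fintype.card_fin]
    have h1 : (K - -K).toNat = 2 * (D + 1) * M := by
      have : K - -K = ((2 * (D + 1) * M : ℕ) : ℤ) := by rw [hK]; push_cast; ring
      rw [this, Int.toNat_natCast]
    rw [h1]
    have h2 : 3 * (D + 1) * (p + 1) ≤ n ^ (3 * (D + 1) * (p + 1)) :=
      (Nat.lt_pow_self hn).le
    calc (2 * (D + 1) * M) ^ p ≤ (3 * (D + 1) * (p + 1) * n ^ m) ^ p := by
          apply Nat.pow_le_pow_left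
          rw [hM]; nlinarith [Nat.zero_le ((D + 1) * (p + 1) * n ^ m)]
      _ ≤ (n ^ (3 * (D + 1) * (p + 1)) * n ^ m) ^ p := by gcongr
      _ = n ^ ((3 * (D + 1) * (p + 1) + m) * p) := by rw [← pow_add, ← pow_mul]
      _ ≤ _ := by
        apply Nat.pow_le_pow_right (by omega)
        nlinarith [Nat.zero_le ((3 * (D + 1) * (p + 1)) * p * m)]

/-! ### Sub-exponential random vectors -/

section SubExponentialVector

variable {Ω : Type*} [MeasurableSpace Ω] {μ : Measure Ω} {p : ℕ}

/-- The coordinates of `V` are sub-exponential at scale `b`. -/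
def SubExpVec (μ : Measure Ω) (V : Ω → EuclideanSpace ℝ (Fin p)) (b : ℝ) : Prop :=
  ∀ j, ∫⁻ ω, ENNReal.ofReal (Real.exp (|V ω j| / b)) ∂μ ≤ 2

theorem SubExpVec.of_psiOneNormVec_le {V : Ω → EuclideanSpace ℝ (Fin p)} {a b : ℝ}
    (h : psiOneNormVec μ V ≤ ENNReal.ofReal a) (hab : a < b) (hb : 0 < b) :
    SubExpVec μ V b := by
  intro j
  have h1 : psiOneNorm μ (fun ω => ⟪EuclideanSpace.single j (1 : ℝ), V ω⟫_ℝ) ≤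
      psiOneNormVec μ V := by
    rw [psiOneNormVec]
    exact le_iSup₂_of_le (EuclideanSpace.single j (1 : ℝ)) (by simp) le_rfl
  have h2 := lintegral_exp_abs_div_le_of_psiOneNorm_lt
    ((h1.trans h).trans_lt ((ENNReal.ofReal_lt_ofReal_iff hb).2 hab))
  simpa [EuclideanSpace.inner_single_left] using h2

variable {V : Ω → EuclideanSpace ℝ (Fin p)} {b : ℝ}

theorem SubExpVec.add {W : Ω → EuclideanSpace ℝ (Fin p)} (hV : SubExpVec μ V b)
    (hW : SubExpVec μ W b) (hm : Measurable V) (hb : 0 < b) :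
    SubExpVec μ (fun ω => V ω + W ω) (2 * b) := fun j =>
  lintegral_exp_abs_add_div_le (X := fun ω => V ω j) (by fun_prop) (hV j) (hW j) hb

theorem SubExpVec.integrable (hV : SubExpVec μ V b) (hm : Measurable V) (hb : 0 < b) :
    Integrable V μ := by
  have h : Integrable (fun ω => ∑ j, |V ω j|) μ := integrable_finsetSum _ fun j _ =>
    (integrable_of_lintegral_exp_abs_div_le (X := fun ω => V ω j) (by fun_prop) hb (hV j)).1.abs
  exact h.mono' hm.aestronglyMeasurable (ae_of_all _ fun ω => EuclideanSpace.norm_le_sum_abs _)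

theorem SubExpVec.norm_integral_le (hV : SubExpVec μ V b) (hm : Measurable V) (hb : 0 < b) :
    ‖∫ ω, V ω ∂μ‖ ≤ p * (2 * b) := by
  have h := fun j => integrable_of_lintegral_exp_abs_div_le (X := fun ω => V ω j) (by fun_prop)
    hb (hV j)
  calc ‖∫ ω, V ω ∂μ‖ ≤ ∫ ω, ‖V ω‖ ∂μ := norm_integral_le_integral_norm _
    _ ≤ ∫ ω, ∑ j, |V ω j| ∂μ := integral_mono (hV.integrable hm hb).norm
        (integrable_finsetSum _ fun j _ => (h j).1.abs)
        fun ω => EuclideanSpace.norm_le_sum_abs _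
    _ = ∑ j, ∫ ω, |V ω j| ∂μ := integral_finsetSum _ fun j _ => (h j).1.abs
    _ ≤ ∑ _j : Fin p, 2 * b := Finset.sum_le_sum fun j _ => (h j).2
    _ = p * (2 * b) := by simp

/-- Union bound over coordinates. The strict inequality on the left keeps the case p = 0 correct,
where the right side is 0. -/
theorem measure_lt_norm_le_of_coordinates {c : ℝ} {ε : ℝ≥0∞}
    (h : ∀ j, μ {ω | c ≤ |V ω j|} ≤ ε) : μ {ω | p * c < ‖V ω‖} ≤ p * ε := by
  have hsub : {ω | p * c < ‖V ω‖} ⊆ ⋃ j ∈ (Finset.univ : Finset (Fin p)), {ω | c ≤ |V ω j|} := by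
    intro ω hω
    by_contra hcon
    simp only [Finset.mem_univ, Set.iUnion_true, Set.mem_iUnion, Set.mem_ofPred_eq, not_exists,
      not_le] at hcon hω
    have h1 : ∑ j, |V ω j| ≤ ∑ _j : Fin p, c := Finset.sum_le_sum fun j _ => (hcon j).le
    have h2 := EuclideanSpace.norm_le_sum_abs (V ω)
    simp at h1
    linarith
  calc _ ≤ _ := measure_mono hsub
    _ ≤ ∑ j : Fin p, μ {ω | c ≤ |V ω j|} := measure_biUnion_finset_le _ _
    _ ≤ ∑ _j : Fin p, ε := Finset.sum_le_sum fun j _ => h j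
    _ = p * ε := by simp

theorem SubExpVec.measure_lt_norm_le (hV : SubExpVec μ V b) (hm : Measurable V) (hb : 0 < b)
    (t : ℝ) : μ {ω | p * (b * t) < ‖V ω‖} ≤ p * ENNReal.ofReal (2 * Real.exp (-t)) :=
  measure_lt_norm_le_of_coordinates fun j =>
    measure_le_abs_of_lintegral_exp_abs_div_le (X := fun ω => V ω j) (by fun_prop) hb (hV j) t

theorem measure_lt_norm_sum_centered_le [IsProbabilityMeasure μ] {Z : Type*} [MeasurableSpace Z]
    {z : ℕ → Ω → Z} {S T : Finset ℕ} (hST : S ⊆ T) (hind : iIndepFun (fun i : T => z i) μ)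
    (hz : ∀ i ∈ T, Measurable (z i)) {f : Z → EuclideanSpace ℝ (Fin p)} (hf : Measurable f)
    (hb : 0 < b) (hV : ∀ i ∈ S, SubExpVec μ (fun ω => f (z i ω)) b) {t : ℝ} (ht : 0 < t) :
    μ {ω | p * (b * (34 * (√(S.card * t) + t))) <
        ‖∑ i ∈ S, (f (z i ω) - ∫ ω', f (z i ω') ∂μ)‖} ≤
      p * ENNReal.ofReal (2 * Real.exp (-t)) := by
  apply measure_lt_norm_le_of_coordinates
  intro j
  have hind' : iIndepFun (fun (i : S) ω => f (z i ω) j) μ := by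
    have h1 := hind.precomp (g := fun i : S => (⟨i, hST i.2⟩ : T)) fun a b h =>
      Subtype.ext (congrArg (fun i : T => (i : ℕ)) h)
    exact h1.comp (fun _ x => f x j) fun _ => by fun_prop
  have h := measure_le_abs_sum_centered hind'
    (fun i => by have := hz i (hST i.2); fun_prop) hb (fun i => hV i i.2 j) ht
  rw [Fintype.card_coe] at h
  convert h using 5 with ω
  have hint : ∀ i ∈ S, (∫ ω', f (z i ω') ∂μ) j = ∫ ω', f (z i ω') j ∂μ := fun i hi => by
    have hmi := hz i (hST hi)
    exact ((EuclideanSpace.proj (𝕜 := ℝ) j).integral_comp_comm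
      ((hV i hi).integrable (by fun_prop) hb)).symm
  rw [Finset.sum_coe_sort S fun i => f (z i ω) j - ∫ ω', f (z i ω') j ∂μ]
  simp only [WithLp.ofLp_sum, WithLp.ofLp_sub, Finset.sum_apply, Pi.sub_apply]
  exact congrArg _ (Finset.sum_congr rfl fun i hi => by rw [hint i hi])

end SubExponentialVector

/-! ### Deterministic consequences of the control of the empirical process on a net -/

/-- The centred empirical loss over `S`. -/
def empNoise {E : Type*} (ℓ ψ : ℕ → E → ℝ) (S : Finset ℕ) (x : E) : ℝ := ∑ i ∈ S, (ℓ i x - ψ i x)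

theorem empNoise_eq {E : Type*} (ℓ ψ : ℕ → E → ℝ) (S : Finset ℕ) (x : E) :
    empNoise ℓ ψ S x = ∑ i ∈ S, ℓ i x - ∑ i ∈ S, ψ i x := Finset.sum_sub_distrib _ _

section Deterministic

variable {E : Type*} [NormedAddCommGroup E] [InnerProductSpace ℝ E]

/-- The realized losses `ℓ i` with subgradients `g i` stay close to the mean losses `ψ i` with
gradients `γ i`: on a fine net `N` of `Θ`, the sums over intervals of the subgradients
and of their increments from the population minimizers `θ₀ S` have Bernstein-type deviations. -/
structure EmpiricalControl (Θ : Set E) (N : Finset E) (n : ℕ) (d C ζ ρ : ℝ)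
    (ℓ ψ : ℕ → E → ℝ) (g γ : ℕ → E → E) (θ₀ : Finset ℕ → E) : Prop where
  two_le : 2 ≤ n
  diam_nonneg : 0 ≤ d
  const_nonneg : 0 ≤ C
  lip_nonneg : 0 ≤ ζ
  modulus_pos : 0 < ρ
  convex : Convex ℝ Θ
  norm_sub_le_diam : ∀ x ∈ Θ, ∀ y ∈ Θ, ‖x - y‖ ≤ d
  net_subset : ∀ q ∈ N, q ∈ Θ
  subgradient : ∀ i ∈ Finset.Ioc 0 n, ∀ x ∈ Θ, ∀ y ∈ Θ, ℓ i x + ⟪g i x, y - x⟫_ℝ ≤ ℓ i y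
  subgradient_mean : ∀ i ∈ Finset.Ioc 0 n, ∀ x ∈ Θ, ∀ y ∈ Θ, ψ i x + ⟪γ i x, y - x⟫_ℝ ≤ ψ i y
  lipschitz_mean : ∀ i ∈ Finset.Ioc 0 n, ∀ x ∈ Θ, ∀ y ∈ Θ, ‖γ i x - γ i y‖ ≤ ζ * ‖x - y‖
  norm_mean_le : ∀ i ∈ Finset.Ioc 0 n, ∀ x ∈ Θ, ‖γ i x‖ ≤ C
  norm_grad_le : ∀ i ∈ Finset.Ioc 0 n, ∀ q ∈ N, ‖g i q‖ ≤ C * Real.log n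
  exists_net : ∀ x ∈ Θ, ∃ q ∈ N, ‖x - q‖ ≤ ((n : ℝ) ^ 3)⁻¹ ∧
    ∀ i ∈ Finset.Ioc 0 n, |ℓ i x - ℓ i q| ≤ C * Real.log n * ((n : ℝ) ^ 3)⁻¹
  deviation : ∀ S, IsInterval n S → ∀ q ∈ N,
    ‖∑ i ∈ S, (g i q - γ i q)‖ ≤ C * (√(S.card * Real.log n) + Real.log n)
  increment : ∀ S, IsInterval n S → ∀ q ∈ N,
    ‖∑ i ∈ S, (g i q - γ i q) - ∑ i ∈ S, (g i (θ₀ S) - γ i (θ₀ S))‖ ≤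
      C * ‖q - θ₀ S‖ * (√(S.card * Real.log n) + Real.log n)
  center_mem : ∀ S, IsInterval n S → θ₀ S ∈ Θ
  sum_mean_center : ∀ S, IsInterval n S → ∑ i ∈ S, γ i (θ₀ S) = 0
  center_min : ∀ S, IsInterval n S → ∀ x ∈ Θ, ∑ i ∈ S, ψ i (θ₀ S) ≤ ∑ i ∈ S, ψ i x
  strongConvex : ∀ S, IsInterval n S →
    StrongConvexOn Θ ρ (fun x => (S.card : ℝ)⁻¹ * ∑ i ∈ S, ψ i x)

theorem IsInterval.subset {n : ℕ} {S : Finset ℕ} (h : IsInterval n S) : S ⊆ Finset.Ioc 0 n := by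
  obtain ⟨s, e, _, hen, rfl⟩ := h
  intro i hi
  rw [Finset.mem_Ioc] at hi ⊢
  omega

theorem IsInterval.card_pos {n : ℕ} {S : Finset ℕ} (h : IsInterval n S) : 0 < S.card := by
  obtain ⟨s, e, hse, _, rfl⟩ := h
  rw [Nat.card_Ioc]
  omega

theorem card_le_of_subset_Ioc {n : ℕ} {S : Finset ℕ} (h : S ⊆ Finset.Ioc 0 n) : S.card ≤ n := by
  simpa using Finset.card_le_card h

/-- Closes the self-bounding inequalities for distances: a squared distance controlled by γ times
the distance plus γ² is of order γ². -/
theorem le_of_sq_le_mul_add {t β γ : ℝ} (hγ : 0 < γ) (hβ : 0 ≤ β)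
    (h : t ^ 2 ≤ β * γ * (t + 2 * γ)) : t ≤ (β + 2) * γ := by
  by_contra hcon
  push Not at hcon
  have h1 : 0 < t := lt_of_le_of_lt (by positivity) hcon
  have h2 : (β + 2) * γ * t < t * t := by gcongr
  have h3 : γ * ((β + 2) * γ) < γ * t := by gcongr
  nlinarith [mul_pos hγ hγ]

/-- Bookkeeping for the last line of `empNoise_sub_le`: the constants are gathered into one factor,
using L ≥ 1/2 to compare with L. -/
theorem affine_le_mul_add {M k k' C L e ε : ℝ} (hM : 0 ≤ M) (hk : 0 ≤ k) (hC : 0 ≤ C)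
    (hL : 1 / 2 ≤ L) (he : 0 ≤ e) (hε : 0 ≤ ε) (hk' : k' = 4 * k) :
    (M + k) * (e + 2 * ε) + 2 * ((2 * C * L + 2 * C + M) * ε) ≤
      (4 + k' + 12 * C) * (M + L) * (e + ε) := by
  have hkL : k ≤ 2 * k * L := by nlinarith
  have hCL : C ≤ 2 * C * L := by nlinarith
  have h0 : 0 ≤ C * L := by nlinarith
  have h1 : M + k ≤ 4 * M + 4 * k * L + 12 * C * L := by linarith
  have h2 : 4 * M + 2 * k + 4 * C * L + 4 * C ≤ 4 * M + 4 * k * L + 12 * C * L := by linarith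
  have h3 : 4 * M + 4 * k * L + 12 * C * L ≤ (4 + 4 * k + 12 * C) * (M + L) := by
    nlinarith [mul_nonneg hk hM, mul_nonneg hC hM]
  rw [hk']
  calc _ = (M + k) * e + (4 * M + 2 * k + 4 * C * L + 4 * C) * ε := by ring
    _ ≤ (4 * M + 4 * k * L + 12 * C * L) * e + (4 * M + 4 * k * L + 12 * C * L) * ε :=
      add_le_add (mul_le_mul_of_nonneg_right h1 he) (mul_le_mul_of_nonneg_right h2 hε)
    _ = (4 * M + 4 * k * L + 12 * C * L) * (e + ε) := by ring
    _ ≤ _ := mul_le_mul_of_nonneg_right h3 (by positivity)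

theorem StrongConvexOn.apply_midpoint_le {Θ : Set E} {ρ : ℝ} {f : E → ℝ}
    (hf : StrongConvexOn Θ ρ f) {x y : E} (hx : x ∈ Θ) (hy : y ∈ Θ) :
    f ((1 / 2 : ℝ) • x + (1 / 2 : ℝ) • y) ≤ 1 / 2 * f x + 1 / 2 * f y - ρ / 8 * ‖x - y‖ ^ 2 := by
  have h := hf.2 hx hy (by norm_num : (0 : ℝ) ≤ 1 / 2) (by norm_num : (0 : ℝ) ≤ 1 / 2)
    (by norm_num)
  simp only [smul_eq_mul] at h
  linarith

variable {Θ : Set E} {N : Finset E} {n : ℕ} {d C ζ ρ : ℝ}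
    {ℓ ψ : ℕ → E → ℝ} {g γ : ℕ → E → E} {θ₀ : Finset ℕ → E}

namespace EmpiricalControl

theorem half_le_log (h : EmpiricalControl Θ N n d C ζ ρ ℓ ψ g γ θ₀) : 1 / 2 ≤ Real.log n := by
  have h1 : Real.log 2 ≤ Real.log n :=
    Real.log_le_log (by norm_num) (by exact_mod_cast h.two_le)
  linarith [Real.log_two_gt_d9]

theorem log_pos (h : EmpiricalControl Θ N n d C ζ ρ ℓ ψ g γ θ₀) : 0 < Real.log n := by
  linarith [h.half_le_log]

theorem cast_two_le (h : EmpiricalControl Θ N n d C ζ ρ ℓ ψ g γ θ₀) : (2 : ℝ) ≤ n := by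
  exact_mod_cast h.two_le

theorem inv_cube_le (h : EmpiricalControl Θ N n d C ζ ρ ℓ ψ g γ θ₀) :
    (n : ℝ) * ((n : ℝ) ^ 3)⁻¹ ≤ (n : ℝ)⁻¹ ∧ ((n : ℝ) ^ 3)⁻¹ ≤ (n : ℝ)⁻¹ ∧
      ((n : ℝ) ^ 3)⁻¹ ≤ 1 ∧ (n : ℝ)⁻¹ ≤ 1 := by
  have h2 := h.cast_two_le
  have e : (n : ℝ) * ((n : ℝ) ^ 3)⁻¹ = (n : ℝ)⁻¹ * (n : ℝ)⁻¹ := by field_simp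
  have h1 : (n : ℝ)⁻¹ ≤ 1 := inv_le_one_of_one_le₀ (by linarith)
  have h0 : 0 < (n : ℝ)⁻¹ := by positivity
  have h3 : ((n : ℝ) ^ 3)⁻¹ ≤ (n : ℝ)⁻¹ := by
    apply inv_anti₀ (by linarith)
    nlinarith [pow_pos (by linarith : (0 : ℝ) < n) 2]
  refine ⟨?_, h3, h3.trans h1, h1⟩
  rw [e]
  nlinarith

/-- A sum over `S` of subgradients is a subgradient of the sum. -/
theorem sum_subgradient (h : EmpiricalControl Θ N n d C ζ ρ ℓ ψ g γ θ₀) {S : Finset ℕ}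
    (hS : S ⊆ Finset.Ioc 0 n) {x y : E} (hx : x ∈ Θ) (hy : y ∈ Θ) :
    ∑ i ∈ S, ℓ i x - ∑ i ∈ S, ℓ i y ≤ ⟪∑ i ∈ S, g i x, x - y⟫_ℝ := by
  rw [← Finset.sum_sub_distrib, sum_inner]
  refine Finset.sum_le_sum fun i hi => ?_
  have := h.subgradient i (hS hi) x hx y hy
  rw [← neg_sub x y, inner_neg_right] at this
  linarith

theorem sum_subgradient_mean (h : EmpiricalControl Θ N n d C ζ ρ ℓ ψ g γ θ₀) {S : Finset ℕ}
    (hS : S ⊆ Finset.Ioc 0 n) {x y : E} (hx : x ∈ Θ) (hy : y ∈ Θ) :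
    ∑ i ∈ S, ψ i x - ∑ i ∈ S, ψ i y ≤ ⟪∑ i ∈ S, γ i x, x - y⟫_ℝ := by
  rw [← Finset.sum_sub_distrib, sum_inner]
  refine Finset.sum_le_sum fun i hi => ?_
  have := h.subgradient_mean i (hS hi) x hx y hy
  rw [← neg_sub x y, inner_neg_right] at this
  linarith

theorem norm_sum_mean_sub_le (h : EmpiricalControl Θ N n d C ζ ρ ℓ ψ g γ θ₀) {S : Finset ℕ}
    (hS : S ⊆ Finset.Ioc 0 n) {x y : E} (hx : x ∈ Θ) (hy : y ∈ Θ) :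
    ‖∑ i ∈ S, γ i x - ∑ i ∈ S, γ i y‖ ≤ S.card * (ζ * ‖x - y‖) := by
  rw [← Finset.sum_sub_distrib, ← nsmul_eq_mul]
  exact norm_sum_le_of_le _ (fun i hi => h.lipschitz_mean i (hS hi) x hx y hy) |>.trans
    (by simp)

/-- The noise is a difference of convex functions. The loss is linearized at x and the mean loss at
y, each giving an upper bound; passing from γ at y to γ at x costs the quadratic term. Only the
values of `g` at the end point x enter. -/
theorem empNoise_step (h : EmpiricalControl Θ N n d C ζ ρ ℓ ψ g γ θ₀) {S : Finset ℕ}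
    (hS : S ⊆ Finset.Ioc 0 n) {a : E} {M s : ℝ} {x y : E} (hx : x ∈ Θ) (hy : y ∈ Θ)
    (hM : ‖∑ i ∈ S, (g i x - γ i x) - a‖ ≤ M) (hs : ‖x - y‖ ≤ s) :
    empNoise ℓ ψ S x - empNoise ℓ ψ S y - ⟪a, x - y⟫_ℝ ≤ M * s + ζ * n * s ^ 2 := by
  have hs0 : 0 ≤ s := (norm_nonneg _).trans hs
  have hcard : (S.card : ℝ) ≤ n := by exact_mod_cast card_le_of_subset_Ioc hS
  have h1 := h.sum_subgradient hS hx hy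
  have h2 := h.sum_subgradient_mean hS hy hx
  have h3 : ⟪∑ i ∈ S, γ i y, y - x⟫_ℝ = -⟪∑ i ∈ S, γ i y, x - y⟫_ℝ := by
    rw [← neg_sub x y, inner_neg_right]
  have h4 : ⟪∑ i ∈ S, (g i x - γ i x) - a, x - y⟫_ℝ ≤ M * s :=
    (real_inner_le_norm _ _).trans (by gcongr; exact (norm_nonneg _).trans hM)
  have h5 : ⟪∑ i ∈ S, γ i x - ∑ i ∈ S, γ i y, x - y⟫_ℝ ≤ ζ * n * s ^ 2 := by
    have h0 := h.lip_nonneg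
    calc _ ≤ _ := real_inner_le_norm _ _
      _ ≤ S.card * (ζ * ‖x - y‖) * ‖x - y‖ := by
        gcongr; exact h.norm_sum_mean_sub_le hS hx hy
      _ ≤ n * (ζ * s) * s := by gcongr
      _ = _ := by ring
  rw [empNoise_eq, empNoise_eq]
  rw [Finset.sum_sub_distrib, inner_sub_left, inner_sub_left] at h4
  rw [inner_sub_left] at h5
  linarith

/-- Replacing a point by its net neighbour. Sums of n scores, and hence `a` up to M, are at most of
order n log n, so the mesh n⁻³ makes the error negligible. -/
theorem empNoise_end (h : EmpiricalControl Θ N n d C ζ ρ ℓ ψ g γ θ₀) {S : Finset ℕ}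
    (hS : S ⊆ Finset.Ioc 0 n) {a : E} {M : ℝ} {x q : E} (hx : x ∈ Θ) (hq : q ∈ N)
    (hM : ‖∑ i ∈ S, (g i q - γ i q) - a‖ ≤ M) (hxq : ‖x - q‖ ≤ ((n : ℝ) ^ 3)⁻¹)
    (hl : ∀ i ∈ Finset.Ioc 0 n, |ℓ i x - ℓ i q| ≤ C * Real.log n * ((n : ℝ) ^ 3)⁻¹) :
    |empNoise ℓ ψ S x - empNoise ℓ ψ S q - ⟪a, x - q⟫_ℝ| ≤
      (2 * C * Real.log n + 2 * C + M) * (n : ℝ)⁻¹ := by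
  have hcard : (S.card : ℝ) ≤ n := by exact_mod_cast card_le_of_subset_Ioc hS
  have hC := h.const_nonneg
  have hL := h.log_pos
  have hM0 : 0 ≤ M := (norm_nonneg _).trans hM
  have hqΘ := h.net_subset q hq
  have h1 : |∑ i ∈ S, ((ℓ i x - ψ i x) - (ℓ i q - ψ i q))| ≤
      n * ((C * Real.log n + C) * ((n : ℝ) ^ 3)⁻¹) := by
    calc _ ≤ ∑ i ∈ S, |(ℓ i x - ψ i x) - (ℓ i q - ψ i q)| := Finset.abs_sum_le_sum_abs _ _
      _ ≤ ∑ i ∈ S, ((C * Real.log n + C) * ((n : ℝ) ^ 3)⁻¹) := by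
        refine Finset.sum_le_sum fun i hi => ?_
        have e1 := h.subgradient_mean i (hS hi) x hx q hqΘ
        have e2 := h.subgradient_mean i (hS hi) q hqΘ x hx
        have e3 : |⟪γ i x, q - x⟫_ℝ| ≤ C * ((n : ℝ) ^ 3)⁻¹ :=
          (abs_real_inner_le_norm _ _).trans (by
            rw [norm_sub_rev]; gcongr; exact h.norm_mean_le i (hS hi) x hx)
        have e4 : |⟪γ i q, x - q⟫_ℝ| ≤ C * ((n : ℝ) ^ 3)⁻¹ :=
          (abs_real_inner_le_norm _ _).trans (by
            gcongr; exact h.norm_mean_le i (hS hi) q hqΘ)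
        have e5 := abs_le.1 e3
        have e6 := abs_le.1 e4
        have e7 := abs_le.1 (hl i (hS hi))
        rw [abs_le]
        constructor <;> linarith
      _ = S.card * ((C * Real.log n + C) * ((n : ℝ) ^ 3)⁻¹) := by simp
      _ ≤ _ := by gcongr
  have ha : ‖a‖ ≤ M + n * (C * Real.log n + C) := by
    have e1 : ‖∑ i ∈ S, (g i q - γ i q)‖ ≤ n * (C * Real.log n + C) := by
      calc _ ≤ ∑ i ∈ S, (C * Real.log n + C) := norm_sum_le_of_le _ fun i hi =>
            (norm_sub_le _ _).trans (add_le_add (h.norm_grad_le i (hS hi) q hq)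
              (h.norm_mean_le i (hS hi) q hqΘ))
        _ = S.card * (C * Real.log n + C) := by rw [Finset.sum_const, nsmul_eq_mul]
        _ ≤ _ := by gcongr
    have e2 := norm_sub_norm_le a (∑ i ∈ S, (g i q - γ i q))
    rw [norm_sub_rev] at e2
    linarith
  have h2 : |⟪a, x - q⟫_ℝ| ≤ (M + n * (C * Real.log n + C)) * ((n : ℝ) ^ 3)⁻¹ :=
    (abs_real_inner_le_norm _ _).trans (by gcongr)
  obtain ⟨h3, h4, -, -⟩ := h.inv_cube_le
  rw [Finset.sum_sub_distrib] at h1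
  calc _ ≤ _ := abs_sub _ _
    _ ≤ _ := add_le_add h1 h2
    _ = 2 * (C * Real.log n + C) * (n * ((n : ℝ) ^ 3)⁻¹) + M * ((n : ℝ) ^ 3)⁻¹ := by ring
    _ ≤ 2 * (C * Real.log n + C) * (n : ℝ)⁻¹ + M * (n : ℝ)⁻¹ := by gcongr
    _ = _ := by ring

/-- The centred empirical loss is almost Lipschitz. -/
theorem empNoise_sub_le (h : EmpiricalControl Θ N n d C ζ ρ ℓ ψ g γ θ₀) {S : Finset ℕ}
    (hS : S ⊆ Finset.Ioc 0 n) {a : E} {M : ℝ} {x y : E} (hx : x ∈ Θ) (hy : y ∈ Θ)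
    (hM : ∀ q ∈ N, (∃ w ∈ segment ℝ y x, ‖q - w‖ ≤ ((n : ℝ) ^ 3)⁻¹) →
      ‖∑ i ∈ S, (g i q - γ i q) - a‖ ≤ M) :
    empNoise ℓ ψ S x - empNoise ℓ ψ S y - ⟪a, x - y⟫_ℝ ≤
      (4 + 4 * ζ * (d + 2) + 12 * C) * (M + Real.log n) * (‖x - y‖ + (n : ℝ)⁻¹) := by
  have hseg : ∀ w ∈ segment ℝ y x, w ∈ Θ := fun w hw => h.convex.segment_subset hy hx hw
  choose! q hqN hq hql using h.exists_net
  have hn2 := h.cast_two_le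
  have hn0 : (0 : ℝ) < n := by linarith
  have hL := h.half_le_log
  have hC := h.const_nonneg
  have hζ := h.lip_nonneg
  have hd := h.diam_nonneg
  -- The segment from y to x is cut into n pieces and each node is replaced by a net point. Steps
  -- then have length about ‖x - y‖/n, so the n quadratic errors ζ n s² add up to order ‖x - y‖² +
  -- 1/n², of which one factor is absorbed by the diameter.
  set w : ℕ → E := fun j => AffineMap.lineMap y x ((j : ℝ) / n) with hw
  have hwseg : ∀ j, j ≤ n → w j ∈ segment ℝ y x := by
    intro j hj
    rw [segment_eq_image_lineMap]
    refine ⟨(j : ℝ) / n, ⟨by positivity, ?_⟩, rfl⟩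
    rw [div_le_one hn0]
    exact_mod_cast hj
  have hwM : ∀ j, j ≤ n → ‖∑ i ∈ S, (g i (q (w j)) - γ i (q (w j))) - a‖ ≤ M := fun j hj =>
    hM _ (hqN _ (hseg _ (hwseg j hj))) ⟨w j, hwseg j hj, by
      rw [norm_sub_rev]; exact hq _ (hseg _ (hwseg j hj))⟩
  have hM0 : 0 ≤ M := (norm_nonneg _).trans (hwM 0 (Nat.zero_le _))
  have hw0 : w 0 = y := by simp [hw]
  have hwn : w n = x := by simp [hw, div_self hn0.ne']
  obtain ⟨hc1, hc2, hc3, hc4⟩ := h.inv_cube_le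
  set s : ℝ := ‖x - y‖ * (n : ℝ)⁻¹ + 2 * ((n : ℝ) ^ 3)⁻¹ with hs
  have hstep : ∀ j, j < n → ‖q (w (j + 1)) - q (w j)‖ ≤ s := by
    intro j hj
    have e1 := hq _ (hseg _ (hwseg j hj.le))
    have e2 := hq _ (hseg _ (hwseg (j + 1) hj))
    have e3 : ‖w (j + 1) - w j‖ = ‖x - y‖ * (n : ℝ)⁻¹ := by
      rw [← dist_eq_norm, hw]
      simp only
      rw [dist_lineMap_lineMap, Real.dist_eq, dist_comm, dist_eq_norm]
      push_cast
      rw [← sub_div, add_sub_cancel_left, one_div, abs_of_pos (by positivity), mul_comm]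
    have e4 : q (w (j + 1)) - q (w j) =
        (w (j + 1) - w j) - (w (j + 1) - q (w (j + 1))) + (w j - q (w j)) := by abel
    rw [e4]
    calc _ ≤ ‖w (j + 1) - w j‖ + ‖w (j + 1) - q (w (j + 1))‖ + ‖w j - q (w j)‖ :=
          (norm_add_le _ _).trans (by gcongr; exact norm_sub_le _ _)
      _ ≤ _ := by rw [e3, hs]; linarith
  set F : E → ℝ := fun v => empNoise ℓ ψ S v - ⟪a, v⟫_ℝ with hF
  have hFsub : ∀ u v, F u - F v = empNoise ℓ ψ S u - empNoise ℓ ψ S v - ⟪a, u - v⟫_ℝ := by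
    intro u v
    rw [hF, inner_sub_right]
    ring
  have htel : F (q (w n)) - F (q (w 0)) ≤ n * (M * s + ζ * n * s ^ 2) := by
    rw [← Finset.sum_range_sub (fun j => F (q (w j))) n]
    calc _ ≤ ∑ j ∈ Finset.range n, (M * s + ζ * n * s ^ 2) := by
          refine Finset.sum_le_sum fun j hj => ?_
          have hj' := Finset.mem_range.1 hj
          rw [hFsub]
          exact h.empNoise_step hS (h.net_subset _ (hqN _ (hseg _ (hwseg (j + 1) hj'))))
            (h.net_subset _ (hqN _ (hseg _ (hwseg j hj'.le)))) (hwM _ hj') (hstep j hj')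
      _ = _ := by rw [Finset.sum_const, nsmul_eq_mul, Finset.card_range]
  have hend1 := h.empNoise_end hS hx (hqN x hx) (hwn ▸ hwM n le_rfl)
    (hq x hx) (hql x hx)
  have hend0 := h.empNoise_end hS hy (hqN y hy) (hw0 ▸ hwM 0 (Nat.zero_le _))
    (hq y hy) (hql y hy)
  rw [← hFsub] at hend1 hend0 ⊢
  rw [hw0, hwn] at htel
  have hxy := h.norm_sub_le_diam x hx y hy
  set e := ‖x - y‖ with he
  have he0 : 0 ≤ e := norm_nonneg _
  have hns : n * s ≤ e + 2 * (n : ℝ)⁻¹ := by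
    have : n * s = e * (n * (n : ℝ)⁻¹) + 2 * (n * ((n : ℝ) ^ 3)⁻¹) := by rw [hs]; ring
    rw [this, mul_inv_cancel₀ hn0.ne']
    linarith
  have hs0 : 0 ≤ s := by positivity
  have hns0 : 0 ≤ n * s := by positivity
  have hni : 0 < (n : ℝ)⁻¹ := by positivity
  have hmain : n * (M * s + ζ * n * s ^ 2) ≤
      (M + ζ * (d + 2)) * (e + 2 * (n : ℝ)⁻¹) := by
    calc n * (M * s + ζ * n * s ^ 2) = (M + ζ * (n * s)) * (n * s) := by ring
      _ ≤ _ := by gcongr; linarith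
  have hup := (abs_le.1 hend1).2
  have hlo := (abs_le.1 hend0).1
  have hfinal : F x - F y ≤ (M + ζ * (d + 2)) * (e + 2 * (n : ℝ)⁻¹) +
      2 * ((2 * C * Real.log n + 2 * C + M) * (n : ℝ)⁻¹) := by linarith
  refine hfinal.trans ?_
  exact affine_le_mul_add hM0 (by positivity) hC hL he0 hni.le (mul_assoc 4 ζ (d + 2))

end EmpiricalControl

end Deterministic

/-! ### Lipschitz bounds for the noise and localization of empirical minimizers. -/

section DeterministicBounds

/-- The Lipschitz constant of the centred empirical loss. -/
noncomputable def noiseConst (d C ζ : ℝ) : ℝ := (4 + 4 * ζ * (d + 2) + 12 * C) * (4 * C + 1)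

theorem noiseConst_pos {d C ζ : ℝ} (hd : 0 ≤ d) (hC : 0 ≤ C) (hζ : 0 ≤ ζ) :
    0 < noiseConst d C ζ := by
  rw [noiseConst]; positivity

/-- Puts a Bernstein bound divided by |I| into the scale-free form √(κu) + u. -/
theorem inv_mul_sqrt_mul_add {m k L : ℝ} (hm : 0 < m) :
    m⁻¹ * (√(k * L) + L) = √(k / m * (L / m)) + L / m := by
  have h : √(k * L) = m * √(k / m * (L / m)) := by
    have e : k * L = m ^ 2 * (k / m * (L / m)) := by field_simp
    rw [e, Real.sqrt_mul (by positivity), Real.sqrt_sq hm.le]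
  rw [h]
  field_simp

variable {E : Type*} [NormedAddCommGroup E] [InnerProductSpace ℝ E]
  {Θ : Set E} {N : Finset E} {n : ℕ} {d C ζ ρ : ℝ}
  {ℓ ψ : ℕ → E → ℝ} {g γ : ℕ → E → E} {θ₀ : Finset ℕ → E}

namespace EmpiricalControl

theorem noiseConst_pos (h : EmpiricalControl Θ N n d C ζ ρ ℓ ψ g γ θ₀) :
    0 < noiseConst d C ζ :=
  _root_.noiseConst_pos h.diam_nonneg h.const_nonneg h.lip_nonneg

/-- The case a = 0 of `empNoise_sub_le`. Empty sets are allowed because either end piece of I \ R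
may be empty. -/
theorem empNoise_Ioc_sub_le (h : EmpiricalControl Θ N n d C ζ ρ ℓ ψ g γ θ₀) {s e : ℕ}
    (he : e ≤ n) {x y : E} (hx : x ∈ Θ) (hy : y ∈ Θ) :
    empNoise ℓ ψ (Finset.Ioc s e) x - empNoise ℓ ψ (Finset.Ioc s e) y ≤
      noiseConst d C ζ * (√((Finset.Ioc s e).card * Real.log n) + Real.log n) *
        (‖x - y‖ + (n : ℝ)⁻¹) := by
  have hL := h.log_pos
  have hC := h.const_nonneg
  have hA := h.noiseConst_pos
  rcases lt_or_ge s e with hse | hse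
  · have hS : IsInterval n (Finset.Ioc s e) := ⟨s, e, hse, he, rfl⟩
    set S := Finset.Ioc s e
    have h1 := h.empNoise_sub_le hS.subset (a := 0)
      (M := C * (√(S.card * Real.log n) + Real.log n)) hx hy
      (fun q hq _ => by rw [sub_zero]; exact h.deviation S hS q hq)
    rw [inner_zero_left, sub_zero] at h1
    refine h1.trans ?_
    rw [noiseConst, mul_assoc (4 + 4 * ζ * (d + 2) + 12 * C) (4 * C + 1)]
    have h2 := h.lip_nonneg
    have h3 := h.diam_nonneg
    have h4 : 0 ≤ √(S.card * Real.log n) := Real.sqrt_nonneg _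
    gcongr
    nlinarith [mul_nonneg hC h4, mul_nonneg hC hL.le]
  · rw [Finset.Ioc_eq_empty (by omega)]
    simp only [empNoise, Finset.sum_empty, sub_self]
    positivity

/-- I \ R consists of at most two intervals, one at each end of I; this is the source of the factor
2. -/
theorem empNoise_sdiff_sub_le (h : EmpiricalControl Θ N n d C ζ ρ ℓ ψ g γ θ₀) {R I : Finset ℕ}
    (hR : IsInterval n R) (hI : IsInterval n I) (hRI : R ⊆ I) {x y : E} (hx : x ∈ Θ)
    (hy : y ∈ Θ) :
    empNoise ℓ ψ (I \ R) x - empNoise ℓ ψ (I \ R) y ≤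
      2 * noiseConst d C ζ * (√((I \ R).card * Real.log n) + Real.log n) *
        (‖x - y‖ + (n : ℝ)⁻¹) := by
  obtain ⟨s, e, hse, hen, rfl⟩ := hI
  obtain ⟨s', e', hse', hen', rfl⟩ := hR
  have hs : s ≤ s' := by
    have := Finset.mem_Ioc.1 (hRI (Finset.mem_Ioc.2 ⟨Nat.lt_succ_self s', hse'⟩))
    omega
  have he : e' ≤ e := (Finset.mem_Ioc.1 (hRI (Finset.mem_Ioc.2 ⟨hse', le_rfl⟩))).2
  have hA := h.noiseConst_pos
  have hL := h.log_pos
  have hsplit : Finset.Ioc s e \ Finset.Ioc s' e' = Finset.Ioc s s' ∪ Finset.Ioc e' e := by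
    ext i
    simp only [Finset.mem_sdiff, Finset.mem_union, Finset.mem_Ioc]
    omega
  have hdisj : Disjoint (Finset.Ioc s s') (Finset.Ioc e' e) := by
    rw [Finset.disjoint_left]
    intro i hi hi'
    rw [Finset.mem_Ioc] at hi hi'
    omega
  have hsum : ∀ v, empNoise ℓ ψ (Finset.Ioc s e \ Finset.Ioc s' e') v =
      empNoise ℓ ψ (Finset.Ioc s s') v + empNoise ℓ ψ (Finset.Ioc e' e) v := fun v => by
    rw [hsplit, empNoise, Finset.sum_union hdisj]; rfl
  have hc1 : (Finset.Ioc s s').card ≤ (Finset.Ioc s e \ Finset.Ioc s' e').card := by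
    rw [hsplit]; exact Finset.card_le_card Finset.subset_union_left
  have hc2 : (Finset.Ioc e' e).card ≤ (Finset.Ioc s e \ Finset.Ioc s' e').card := by
    rw [hsplit]; exact Finset.card_le_card Finset.subset_union_right
  have h1 := h.empNoise_Ioc_sub_le (s := s) (e := s') (by omega) hx hy
  have h2 := h.empNoise_Ioc_sub_le (s := e') (e := e) hen hx hy
  rw [hsum, hsum]
  set k := (Finset.Ioc s e \ Finset.Ioc s' e').card
  have mono : ∀ m : ℕ, m ≤ k → noiseConst d C ζ * (√(m * Real.log n) + Real.log n) *
        (‖x - y‖ + (n : ℝ)⁻¹) ≤ noiseConst d C ζ * (√(k * Real.log n) + Real.log n) *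
        (‖x - y‖ + (n : ℝ)⁻¹) := fun m hm => by gcongr
  have h3 := mono _ hc1
  have h4 := mono _ hc2
  linarith

/-- Near the population minimizer, the centred empirical loss is linear up to a function with a
small Lipschitz constant. -/
theorem empNoise_sub_inner_le (h : EmpiricalControl Θ N n d C ζ ρ ℓ ψ g γ θ₀) {S : Finset ℕ}
    (hS : IsInterval n S) {x y : E} {D : ℝ} (hx : x ∈ Θ) (hy : y ∈ Θ)
    (hxD : ‖x - θ₀ S‖ ≤ D) (hyD : ‖y - θ₀ S‖ ≤ D) :
    empNoise ℓ ψ S x - empNoise ℓ ψ S y -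
        ⟪∑ i ∈ S, (g i (θ₀ S) - γ i (θ₀ S)), x - y⟫_ℝ ≤
      noiseConst d C ζ * (D * (√(S.card * Real.log n) + Real.log n) + Real.log n) *
        (‖x - y‖ + (n : ℝ)⁻¹) := by
  have hL := h.half_le_log
  have hC := h.const_nonneg
  have hD : 0 ≤ D := (norm_nonneg _).trans hxD
  set L := Real.log n
  set B := √(S.card * L) + L with hB
  have hsq0 : 0 ≤ √(S.card * L) := Real.sqrt_nonneg _
  have hB0 : 0 ≤ B := by linarith
  obtain ⟨hc1, hc2, hc3, hc4⟩ := h.inv_cube_le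
  have h1 := h.empNoise_sub_le hS.subset (a := ∑ i ∈ S, (g i (θ₀ S) - γ i (θ₀ S)))
    -- Subtracting the score noise at θ₀ S leaves increments, which are proportional to the distance
    -- to θ₀ S. Balls are convex, so the whole segment stays within D and its net neighbours within
    -- D + n⁻³.
    (M := C * (D + ((n : ℝ) ^ 3)⁻¹) * B) hx hy (by
      rintro q hq ⟨w, hw, hqw⟩
      refine (h.increment S hS q hq).trans ?_
      have hwD : ‖w - θ₀ S‖ ≤ D := by
        have := (convex_closedBall (θ₀ S) D).segment_subset
          (by rwa [mem_closedBall_iff_norm]) (by rwa [mem_closedBall_iff_norm]) hw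
        rwa [mem_closedBall_iff_norm] at this
      have hqD : ‖q - θ₀ S‖ ≤ D + ((n : ℝ) ^ 3)⁻¹ := by
        have := norm_add_le (q - w) (w - θ₀ S)
        rw [sub_add_sub_cancel] at this
        linarith
      gcongr)
  refine h1.trans ?_
  have hcard : (S.card : ℝ) ≤ n := by exact_mod_cast card_le_of_subset_Ioc hS.subset
  have hsq : √(S.card * L) ≤ n + L := by
    apply Real.sqrt_le_iff.2 ⟨by positivity, ?_⟩
    have h0 : (0 : ℝ) ≤ n := by positivity
    have : (S.card : ℝ) * L ≤ n * L := by gcongr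
    nlinarith
  have hcB : ((n : ℝ) ^ 3)⁻¹ * B ≤ 4 * L := by
    have : 0 < ((n : ℝ) ^ 3)⁻¹ := by have := h.cast_two_le; positivity
    calc ((n : ℝ) ^ 3)⁻¹ * B ≤ ((n : ℝ) ^ 3)⁻¹ * (n + 2 * L) := by gcongr; linarith
      _ = n * ((n : ℝ) ^ 3)⁻¹ + 2 * L * ((n : ℝ) ^ 3)⁻¹ := by ring
      _ ≤ 1 + 2 * L * 1 := by gcongr; linarith
      _ ≤ _ := by linarith
  have h5 : C * (D + ((n : ℝ) ^ 3)⁻¹) * B + L ≤ (4 * C + 1) * (D * B + L) := by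
    have e1 : C * (((n : ℝ) ^ 3)⁻¹ * B) ≤ C * (4 * L) := by gcongr
    have e2 : 0 ≤ D * B := by positivity
    nlinarith [mul_nonneg hC e2]
  rw [noiseConst, mul_assoc (4 + 4 * ζ * (d + 2) + 12 * C) (4 * C + 1)]
  have h2 := h.lip_nonneg
  have h3 := h.diam_nonneg
  gcongr

/-- Quadratic growth of the mean loss around its minimizer. -/
theorem mean_growth (h : EmpiricalControl Θ N n d C ζ ρ ℓ ψ g γ θ₀) {S : Finset ℕ}
    (hS : IsInterval n S) {x : E} (hx : x ∈ Θ) :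
    ρ / 4 * ‖x - θ₀ S‖ ^ 2 ≤
      (S.card : ℝ)⁻¹ * (∑ i ∈ S, ψ i x - ∑ i ∈ S, ψ i (θ₀ S)) := by
  have hc := h.center_mem S hS
  -- The midpoint value is at least the minimum; doubling the resulting inequality gives the factor
  -- ρ/4.
  have h1 := (h.strongConvex S hS).apply_midpoint_le hx hc
  have h2 := h.center_min S hS ((1 / 2 : ℝ) • x + (1 / 2 : ℝ) • θ₀ S)
    (h.convex hx hc (by norm_num) (by norm_num) (by norm_num))
  have h3 : (S.card : ℝ)⁻¹ * ∑ i ∈ S, ψ i (θ₀ S) ≤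
      (S.card : ℝ)⁻¹ * ∑ i ∈ S, ψ i ((1 / 2 : ℝ) • x + (1 / 2 : ℝ) • θ₀ S) := by gcongr
  rw [mul_sub]
  linarith

theorem inv_le_two_mul (h : EmpiricalControl Θ N n d C ζ ρ ℓ ψ g γ θ₀) {S : Finset ℕ}
    (hS : IsInterval n S) : (n : ℝ)⁻¹ ≤ 2 * (Real.log n / S.card) := by
  have hc : (0 : ℝ) < S.card := by exact_mod_cast hS.card_pos
  have hcard : (S.card : ℝ) ≤ n := by exact_mod_cast card_le_of_subset_Ioc hS.subset
  have := h.half_le_log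
  calc (n : ℝ)⁻¹ ≤ (S.card : ℝ)⁻¹ := inv_anti₀ hc hcard
    _ = 1 / S.card := (one_div _).symm
    _ ≤ 2 * Real.log n / S.card := by gcongr; linarith
    _ = _ := by ring

/-- An empirical minimizer is close to the population minimizer. -/
theorem norm_sub_center_le (h : EmpiricalControl Θ N n d C ζ ρ ℓ ψ g γ θ₀) {S : Finset ℕ}
    (hS : IsInterval n S) {x : E} (hx : x ∈ Θ)
    (hmin : ∑ i ∈ S, ℓ i x ≤ ∑ i ∈ S, ℓ i (θ₀ S)) :
    ‖x - θ₀ S‖ ≤ (4 / ρ * noiseConst d C ζ + 2) *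
      (√(Real.log n / S.card) + Real.log n / S.card) := by
  have hc : (0 : ℝ) < S.card := by exact_mod_cast hS.card_pos
  have hA := h.noiseConst_pos
  have hρ := h.modulus_pos
  have hn := h.inv_le_two_mul hS
  have hgrow := h.mean_growth hS hx
  obtain ⟨s, e, hse, hen, rfl⟩ := id hS
  have hnoise := h.empNoise_Ioc_sub_le (s := s) hen (h.center_mem _ hS) hx
  set S := Finset.Ioc s e
  have hu : 0 < Real.log n / S.card := div_pos h.log_pos hc
  set u := Real.log n / S.card
  set A := noiseConst d C ζ
  have hsq : 0 ≤ √u := Real.sqrt_nonneg _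
  set t := ‖x - θ₀ S‖ with ht
  rw [norm_sub_rev, ← ht, empNoise_eq, empNoise_eq] at hnoise
  have hid : (S.card : ℝ)⁻¹ * (√(S.card * Real.log n) + Real.log n) = √u + u := by
    rw [inv_mul_sqrt_mul_add hc, div_self hc.ne', one_mul]
  have h1 : (S.card : ℝ)⁻¹ * (∑ i ∈ S, ψ i x - ∑ i ∈ S, ψ i (θ₀ S)) ≤
      A * (√u + u) * (t + (n : ℝ)⁻¹) := by
    rw [← hid]
    calc _ ≤ (S.card : ℝ)⁻¹ * (A * (√(S.card * Real.log n) + Real.log n) * (t + (n : ℝ)⁻¹)) := by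
          gcongr
          linarith
      _ = _ := by ring
  -- Quadratic growth of the mean loss against an almost Lipschitz noise.
  have h2 : t ^ 2 ≤ 4 / ρ * A * (√u + u) * (t + 2 * (√u + u)) := by
    have e1 : ρ / 4 * t ^ 2 ≤ A * (√u + u) * (t + 2 * (√u + u)) := by
      refine (hgrow.trans h1).trans ?_
      gcongr
      linarith
    calc t ^ 2 = 4 / ρ * (ρ / 4 * t ^ 2) := by field_simp
      _ ≤ 4 / ρ * (A * (√u + u) * (t + 2 * (√u + u))) := by gcongr
      _ = _ := by ring
  exact le_of_sq_le_mul_add (by positivity) (by positivity) h2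

end EmpiricalControl

end DeterministicBounds

/-! ### Upper and lower inequalities for the excess loss, and their combination. -/

section ExcessLoss

/-- The localization constant of empirical minimizers. -/
noncomputable def localConst (d C ζ ρ : ℝ) : ℝ := 4 / ρ * noiseConst d C ζ + 2

/-- The constant of the upper bound on the excess loss. -/
noncomputable def upperConst (d C ζ ρ r₀ : ℝ) : ℝ :=
  2 * noiseConst d C ζ + 1 + ζ * localConst d C ζ ρ / r₀

/-- The constant of the lower bound on the excess loss. -/
noncomputable def lowerConst (d C ζ ρ r₀ : ℝ) : ℝ :=
  2 * (noiseConst d C ζ * (4 * (localConst d C ζ ρ / r₀ + 4 / ρ) + 2 * d + 1))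

/-- The constant of the final bound on the excess loss. -/
noncomputable def excessConst (d C ζ ρ r₀ : ℝ) : ℝ :=
  3 * (upperConst d C ζ ρ r₀ *
    (4 / ρ * (upperConst d C ζ ρ r₀ + lowerConst d C ζ ρ r₀) + 2 + 2))

theorem excess_consts_pos {d C ζ ρ r₀ : ℝ} (hd : 0 ≤ d) (hC : 0 ≤ C) (hζ : 0 ≤ ζ) (hρ : 0 < ρ)
    (hr₀ : 0 < r₀) : 0 < localConst d C ζ ρ ∧ 0 < upperConst d C ζ ρ r₀ ∧
      0 < lowerConst d C ζ ρ r₀ ∧ 0 < excessConst d C ζ ρ r₀ := by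
  have hA := noiseConst_pos hd hC hζ
  have h1 : 0 < localConst d C ζ ρ := by rw [localConst]; positivity
  have h2 : 0 < upperConst d C ζ ρ r₀ := by rw [upperConst]; positivity
  have h3 : 0 < lowerConst d C ζ ρ r₀ := by rw [lowerConst]; positivity
  exact ⟨h1, h2, h3, by rw [excessConst]; positivity⟩

/-- Localization radius times noise rate. For u ≤ 1 the product √u · √u gives u and b√u ≤ b; for u ≥
1 the localized radius would be too large, but the diameter d suffices since √u ≤ u. -/
theorem min_mul_sqrt_add_le {d k u b : ℝ} (hd : 0 ≤ d) (hk : 0 ≤ k) (hu : 0 ≤ u) (hb : 0 ≤ b) :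
    min d (k * (√u + u + b)) * (√u + u) ≤ (4 * k + 2 * d) * (b + u) := by
  have hs : 0 ≤ √u := Real.sqrt_nonneg u
  have hss : √u * √u = u := Real.mul_self_sqrt hu
  have hdb : 0 ≤ d * b := mul_nonneg hd hb
  have hdu : 0 ≤ d * u := mul_nonneg hd hu
  have hku : 0 ≤ k * u := mul_nonneg hk hu
  have hkb : 0 ≤ k * b := mul_nonneg hk hb
  rcases le_total u 1 with h1 | h1
  · have hs1 : √u ≤ 1 := Real.sqrt_le_one.2 h1
    have hus : u ≤ √u := by nlinarith
    calc _ ≤ (k * (√u + u + b)) * (√u + u) := by gcongr; exact min_le_right _ _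
      _ ≤ (k * (2 * √u + b)) * (2 * √u) := by gcongr <;> linarith
      _ = 4 * (k * u) + 2 * (k * b) * √u := by linear_combination 4 * k * hss
      _ ≤ 4 * (k * u) + 2 * (k * b) * 1 := by gcongr
      _ ≤ _ := by nlinarith
  · have hus : √u ≤ u := by
      have : 1 ≤ √u := Real.one_le_sqrt.2 h1
      nlinarith
    calc _ ≤ d * (u + u) := by gcongr; exact min_le_left _ _
      _ ≤ _ := by nlinarith

variable {E : Type*} [NormedAddCommGroup E] [InnerProductSpace ℝ E]
  {Θ : Set E} {N : Finset E} {n : ℕ} {d C ζ ρ : ℝ}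
  {ℓ ψ : ℕ → E → ℝ} {g γ : ℕ → E → E} {θ₀ : Finset ℕ → E}

namespace EmpiricalControl

theorem sum_mean_sdiff_center (h : EmpiricalControl Θ N n d C ζ ρ ℓ ψ g γ θ₀) {R I : Finset ℕ}
    (hR : IsInterval n R) (hRI : R ⊆ I) :
    ∑ i ∈ I \ R, γ i (θ₀ R) = ∑ i ∈ I, γ i (θ₀ R) := by
  rw [← Finset.sum_sdiff hRI, h.sum_mean_center R hR, add_zero]

/-- Quadratic growth at θ₀ I against the slope at θ₀ R. That slope is exactly the bias, because the
mean scores over R vanish at θ₀ R. -/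
theorem norm_center_sub_center_le (h : EmpiricalControl Θ N n d C ζ ρ ℓ ψ g γ θ₀)
    {R I : Finset ℕ} (hR : IsInterval n R) (hI : IsInterval n I) (hRI : R ⊆ I) :
    ‖θ₀ R - θ₀ I‖ ≤ 4 / ρ * ‖(I.card : ℝ)⁻¹ • ∑ i ∈ I \ R, γ i (θ₀ R)‖ := by
  have hρ := h.modulus_pos
  rw [h.sum_mean_sdiff_center hR hRI]
  have h1 := h.mean_growth hI (h.center_mem R hR)
  have h2 := h.sum_subgradient_mean hI.subset (h.center_mem R hR) (h.center_mem I hI)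
  have h3 : (I.card : ℝ)⁻¹ * (∑ i ∈ I, ψ i (θ₀ R) - ∑ i ∈ I, ψ i (θ₀ I)) ≤
      ‖(I.card : ℝ)⁻¹ • ∑ i ∈ I, γ i (θ₀ R)‖ * ‖θ₀ R - θ₀ I‖ := by
    refine le_trans ?_ (real_inner_le_norm _ _)
    rw [real_inner_smul_left]
    gcongr
  set b := ‖(I.card : ℝ)⁻¹ • ∑ i ∈ I, γ i (θ₀ R)‖
  set t := ‖θ₀ R - θ₀ I‖
  have ht : 0 ≤ t := norm_nonneg _
  have hb : 0 ≤ b := norm_nonneg _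
  rcases ht.eq_or_lt with h0 | h0
  · rw [← h0]; positivity
  · have : ρ / 4 * t * t ≤ b * t := by nlinarith
    have := le_of_mul_le_mul_right this h0
    calc t = 4 / ρ * (ρ / 4 * t) := by field_simp
      _ ≤ _ := by gcongr

/-- Restates `norm_sub_center_le` in terms of |I|; the coverage costs 1/r₀, also under the square
root since r₀ ≤ 1. -/
theorem norm_sub_center_le_of_cover (h : EmpiricalControl Θ N n d C ζ ρ ℓ ψ g γ θ₀)
    {r₀ : ℝ} (hr₀ : 0 < r₀) (hr₁ : r₀ ≤ 1) {R I : Finset ℕ} (hR : IsInterval n R)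
    (hI : IsInterval n I) (hcov : r₀ * I.card ≤ R.card) {x : E} (hx : x ∈ Θ)
    (hmin : ∑ i ∈ R, ℓ i x ≤ ∑ i ∈ R, ℓ i (θ₀ R)) :
    ‖x - θ₀ R‖ ≤ localConst d C ζ ρ / r₀ *
      (√(Real.log n / I.card) + Real.log n / I.card) := by
  have hcR : (0 : ℝ) < R.card := by exact_mod_cast hR.card_pos
  have hcI : (0 : ℝ) < I.card := by exact_mod_cast hI.card_pos
  have hL := h.log_pos
  have hB := (excess_consts_pos h.diam_nonneg h.const_nonneg h.lip_nonneg h.modulus_pos hr₀).1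
  have h1 := h.norm_sub_center_le hR hx hmin
  have hu : Real.log n / R.card ≤ Real.log n / I.card / r₀ := by
    rw [div_div, mul_comm (I.card : ℝ)]
    gcongr
  have hsu : √(Real.log n / R.card) ≤ √(Real.log n / I.card) / r₀ := by
    refine (Real.sqrt_le_sqrt hu).trans ?_
    rw [Real.sqrt_div (by positivity)]
    have : r₀ ≤ √r₀ := by
      apply Real.le_sqrt_of_sq_le
      nlinarith
    gcongr
  refine h1.trans ?_
  rw [← localConst]
  calc _ ≤ localConst d C ζ ρ * (√(Real.log n / I.card) / r₀ + Real.log n / I.card / r₀) := by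
        gcongr
    _ = _ := by ring

variable {R I : Finset ℕ} {x y : E} {r₀ : ℝ}

theorem excess_le (h : EmpiricalControl Θ N n d C ζ ρ ℓ ψ g γ θ₀)
    (hr₀ : 0 < r₀) (hr₁ : r₀ ≤ 1) (hR : IsInterval n R) (hI : IsInterval n I) (hRI : R ⊆ I)
    (hcov : r₀ * I.card ≤ R.card) (hx : x ∈ Θ) (hxR : ∀ v ∈ Θ, ∑ i ∈ R, ℓ i x ≤ ∑ i ∈ R, ℓ i v)
    (hy : y ∈ Θ) :
    (I.card : ℝ)⁻¹ * (∑ i ∈ I, ℓ i x - ∑ i ∈ I, ℓ i y) ≤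
      upperConst d C ζ ρ r₀ * (‖(I.card : ℝ)⁻¹ • ∑ i ∈ I \ R, γ i (θ₀ R)‖ +
        √((I \ R).card / I.card * (Real.log n / I.card)) + Real.log n / I.card) *
        (‖x - y‖ + (n : ℝ)⁻¹) := by
  have hcI : (0 : ℝ) < I.card := by exact_mod_cast hI.card_pos
  have hL := h.log_pos
  have hζ := h.lip_nonneg
  have hA := h.noiseConst_pos
  have hB := (excess_consts_pos h.diam_nonneg h.const_nonneg h.lip_nonneg h.modulus_pos hr₀).1
  have hsub : I \ R ⊆ Finset.Ioc 0 n := Finset.sdiff_subset.trans hI.subset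
  have hloc := h.norm_sub_center_le_of_cover hr₀ hr₁ hR hI hcov hx (hxR _ (h.center_mem R hR))
  have hnoise := h.empNoise_sdiff_sub_le hR hI hRI hx hy
  have hmean := h.sum_subgradient_mean hsub hx hy
  have hlip := h.norm_sum_mean_sub_le hsub hx (h.center_mem R hR)
  have hκ1 : ((I \ R).card : ℝ) / I.card ≤ 1 := by
    rw [div_le_one hcI]
    exact_mod_cast Finset.card_le_card Finset.sdiff_subset
  have hκ0 : 0 ≤ ((I \ R).card : ℝ) / I.card := by positivity
  set κ : ℝ := (I \ R).card / I.card with hκ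
  set u := Real.log n / I.card with hu
  have hu0 : 0 < u := by positivity
  set b := ‖(I.card : ℝ)⁻¹ • ∑ i ∈ I \ R, γ i (θ₀ R)‖ with hb
  have hb0 : 0 ≤ b := norm_nonneg _
  set B := localConst d C ζ ρ
  set A := noiseConst d C ζ
  set e := ‖x - y‖
  have he : 0 ≤ e := norm_nonneg _
  have hni : (0 : ℝ) ≤ (n : ℝ)⁻¹ := by positivity
  -- Optimality of x on R discards the indices in R.
  have h1 : (I.card : ℝ)⁻¹ * (∑ i ∈ I, ℓ i x - ∑ i ∈ I, ℓ i y) ≤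
      (I.card : ℝ)⁻¹ * (∑ i ∈ I \ R, ℓ i x - ∑ i ∈ I \ R, ℓ i y) := by
    gcongr ?_ * ?_
    rw [← Finset.sum_sdiff hRI, ← Finset.sum_sdiff hRI]
    linarith [hxR y hy]
  have h2 : (I.card : ℝ)⁻¹ * (empNoise ℓ ψ (I \ R) x - empNoise ℓ ψ (I \ R) y) ≤
      2 * A * (√(κ * u) + u) * (e + (n : ℝ)⁻¹) := by
    calc _ ≤ _ := mul_le_mul_of_nonneg_left hnoise (by positivity : 0 ≤ (I.card : ℝ)⁻¹)
      _ = 2 * A * ((I.card : ℝ)⁻¹ * (√((I \ R).card * Real.log n) + Real.log n)) *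
          (e + (n : ℝ)⁻¹) := by ring
      _ = _ := by rw [inv_mul_sqrt_mul_add hcI]
  -- Since κ ≤ 1, the localization error weighted by κ stays within the noise rate of I \ R.
  have hκs : κ * (√u + u) ≤ √(κ * u) + u := by
    rw [Real.sqrt_mul hκ0]
    have e1 : κ ≤ √κ := Real.le_sqrt_of_sq_le (by nlinarith)
    have e2 : κ * u ≤ 1 * u := by gcongr
    have e3 : κ * √u ≤ √κ * √u := by gcongr
    linarith
  have h3 : (I.card : ℝ)⁻¹ * (∑ i ∈ I \ R, ψ i x - ∑ i ∈ I \ R, ψ i y) ≤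
      (b + ζ * B / r₀ * (√(κ * u) + u)) * e := by
    have e1 : ‖(I.card : ℝ)⁻¹ • ∑ i ∈ I \ R, γ i x‖ ≤ b + κ * (ζ * ‖x - θ₀ R‖) := by
      have e2 : (I.card : ℝ)⁻¹ • ∑ i ∈ I \ R, γ i x =
          (I.card : ℝ)⁻¹ • ∑ i ∈ I \ R, γ i (θ₀ R) +
          (I.card : ℝ)⁻¹ • (∑ i ∈ I \ R, γ i x - ∑ i ∈ I \ R, γ i (θ₀ R)) := by
        rw [← smul_add, add_sub_cancel]
      rw [e2]
      refine (norm_add_le _ _).trans ?_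
      rw [← hb]
      gcongr
      rw [norm_smul, Real.norm_of_nonneg (by positivity)]
      calc _ ≤ (I.card : ℝ)⁻¹ * ((I \ R).card * (ζ * ‖x - θ₀ R‖)) := by gcongr
        _ = _ := by rw [hκ]; ring
    have e3 : κ * (ζ * ‖x - θ₀ R‖) ≤ ζ * B / r₀ * (√(κ * u) + u) := by
      calc _ ≤ κ * (ζ * (B / r₀ * (√u + u))) := by gcongr
        _ = ζ * B / r₀ * (κ * (√u + u)) := by ring
        _ ≤ _ := by gcongr
    calc _ ≤ (I.card : ℝ)⁻¹ * ⟪∑ i ∈ I \ R, γ i x, x - y⟫_ℝ := by gcongr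
      _ = ⟪(I.card : ℝ)⁻¹ • ∑ i ∈ I \ R, γ i x, x - y⟫_ℝ := by rw [real_inner_smul_left]
      _ ≤ _ := real_inner_le_norm _ _
      _ ≤ _ := by gcongr; linarith
  have hs0 : 0 ≤ √(κ * u) := Real.sqrt_nonneg _
  refine h1.trans ?_
  have h4 : (I.card : ℝ)⁻¹ * (∑ i ∈ I \ R, ℓ i x - ∑ i ∈ I \ R, ℓ i y) =
      (I.card : ℝ)⁻¹ * (empNoise ℓ ψ (I \ R) x - empNoise ℓ ψ (I \ R) y) +
      (I.card : ℝ)⁻¹ * (∑ i ∈ I \ R, ψ i x - ∑ i ∈ I \ R, ψ i y) := by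
    rw [empNoise_eq, empNoise_eq]; ring
  rw [h4, upperConst]
  set k := ζ * B / r₀
  have hk : 0 ≤ k := by positivity
  calc _ ≤ 2 * A * (√(κ * u) + u) * (e + (n : ℝ)⁻¹) + (b + k * (√(κ * u) + u)) * e :=
        add_le_add h2 h3
    _ ≤ 2 * A * (b + √(κ * u) + u) * (e + (n : ℝ)⁻¹) +
        (1 * (b + √(κ * u) + u) + k * (b + √(κ * u) + u)) * (e + (n : ℝ)⁻¹) := by
      gcongr <;> linarith
    _ = _ := by ring

/-- Strong convexity bounds e² by the midpoint gap of the mean loss, which is at most half the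
excess plus the second difference of the noise. The score noise at θ₀ I is linear and drops out of
that difference, so no √u remains. -/
theorem le_excess (h : EmpiricalControl Θ N n d C ζ ρ ℓ ψ g γ θ₀)
    (hr₀ : 0 < r₀) (hr₁ : r₀ ≤ 1) (hR : IsInterval n R) (hI : IsInterval n I) (hRI : R ⊆ I)
    (hcov : r₀ * I.card ≤ R.card) (hx : x ∈ Θ) (hxR : ∀ v ∈ Θ, ∑ i ∈ R, ℓ i x ≤ ∑ i ∈ R, ℓ i v)
    (hy : y ∈ Θ) (hyI : ∀ v ∈ Θ, ∑ i ∈ I, ℓ i y ≤ ∑ i ∈ I, ℓ i v) :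
    ρ / 4 * ‖x - y‖ ^ 2 ≤ (I.card : ℝ)⁻¹ * (∑ i ∈ I, ℓ i x - ∑ i ∈ I, ℓ i y) +
      lowerConst d C ζ ρ r₀ * (‖(I.card : ℝ)⁻¹ • ∑ i ∈ I \ R, γ i (θ₀ R)‖ +
        Real.log n / I.card) * (‖x - y‖ + (n : ℝ)⁻¹) := by
  have hcI : (0 : ℝ) < I.card := by exact_mod_cast hI.card_pos
  have hL := h.log_pos
  have hd := h.diam_nonneg
  have hρ := h.modulus_pos
  have hA := h.noiseConst_pos
  have hB := (excess_consts_pos h.diam_nonneg h.const_nonneg h.lip_nonneg h.modulus_pos hr₀).1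
  have hlocx := h.norm_sub_center_le_of_cover hr₀ hr₁ hR hI hcov hx (hxR _ (h.center_mem R hR))
  have hlocy := h.norm_sub_center_le_of_cover hr₀ hr₁ hI hI
    (mul_le_of_le_one_left hcI.le hr₁) hy (hyI _ (h.center_mem I hI))
  have hcen := h.norm_center_sub_center_le hR hI hRI
  have hdx := h.norm_sub_le_diam x hx _ (h.center_mem I hI)
  have hdy := h.norm_sub_le_diam y hy _ (h.center_mem I hI)
  set u := Real.log n / I.card with hu
  have hu0 : 0 < u := by positivity
  have hsu : 0 ≤ √u := Real.sqrt_nonneg _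
  set b := ‖(I.card : ℝ)⁻¹ • ∑ i ∈ I \ R, γ i (θ₀ R)‖ with hb
  have hb0 : 0 ≤ b := norm_nonneg _
  set k := localConst d C ζ ρ / r₀ + 4 / ρ with hk
  have hB' : 0 < localConst d C ζ ρ / r₀ := by positivity
  have hρ' : 0 < 4 / ρ := by positivity
  set D := min d (k * (√u + u + b)) with hD
  have hxD : ‖x - θ₀ I‖ ≤ D := by
    refine le_min hdx ?_
    have := norm_add_le (x - θ₀ R) (θ₀ R - θ₀ I)
    rw [sub_add_sub_cancel] at this
    have e1 : 0 ≤ localConst d C ζ ρ / r₀ * b := by positivity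
    have e2 : 0 ≤ 4 / ρ * (√u + u) := by positivity
    calc _ ≤ _ := this
      _ ≤ localConst d C ζ ρ / r₀ * (√u + u) + 4 / ρ * b := add_le_add hlocx hcen
      _ ≤ _ := by rw [hk]; nlinarith
  have hyD : ‖y - θ₀ I‖ ≤ D := by
    refine le_min hdy (hlocy.trans ?_)
    have e1 : localConst d C ζ ρ / r₀ ≤ k := by rw [hk]; linarith
    exact mul_le_mul e1 (by linarith) (by positivity) (hB'.le.trans e1)
  set m := (1 / 2 : ℝ) • x + (1 / 2 : ℝ) • y with hm
  have hmΘ : m ∈ Θ := h.convex hx hy (by norm_num) (by norm_num) (by norm_num)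
  have hmD : ‖m - θ₀ I‖ ≤ D := by
    have := convex_closedBall (θ₀ I) D (mem_closedBall_iff_norm.2 hxD)
      (mem_closedBall_iff_norm.2 hyD) (by norm_num : (0 : ℝ) ≤ 1 / 2)
      (by norm_num : (0 : ℝ) ≤ 1 / 2) (by norm_num)
    rwa [← hm, mem_closedBall_iff_norm] at this
  have hmx : m - x = (1 / 2 : ℝ) • (y - x) := by rw [hm]; module
  have hmy : m - y = (1 / 2 : ℝ) • (x - y) := by rw [hm]; module
  -- The displacements from x and from y to m are opposite, so the inner products with the score
  -- noise cancel when the two bounds are added.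
  have nx := h.empNoise_sub_inner_le hI hmΘ hx hmD hxD
  have ny := h.empNoise_sub_inner_le hI hmΘ hy hmD hyD
  rw [hmx, real_inner_smul_right, ← neg_sub x y, inner_neg_right, norm_smul, norm_neg] at nx
  rw [hmy, real_inner_smul_right, norm_smul] at ny
  rw [Real.norm_of_nonneg (by norm_num)] at nx ny
  set e := ‖x - y‖ with he
  have he0 : 0 ≤ e := norm_nonneg _
  have hsc := (h.strongConvex I hI).apply_midpoint_le hx hy
  rw [← hm, ← he] at hsc
  have hym := hyI m hmΘ
  have hQ : (I.card : ℝ)⁻¹ * (noiseConst d C ζ *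
      (D * (√(I.card * Real.log n) + Real.log n) + Real.log n) * (1 / 2 * e + (n : ℝ)⁻¹)) ≤
      noiseConst d C ζ * (4 * k + 2 * d + 1) * (b + u) * (e + (n : ℝ)⁻¹) := by
    have hid : (I.card : ℝ)⁻¹ * (√(I.card * Real.log n) + Real.log n) = √u + u := by
      rw [inv_mul_sqrt_mul_add hcI, div_self hcI.ne', one_mul]
    have hmin := min_mul_sqrt_add_le hd (by positivity : 0 ≤ k) hu0.le hb0
    rw [← hD] at hmin
    have hD0 : 0 ≤ D := (norm_nonneg _).trans hxD
    calc _ = noiseConst d C ζ * (D * ((I.card : ℝ)⁻¹ * (√(I.card * Real.log n) + Real.log n)) + u) *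
          (1 / 2 * e + (n : ℝ)⁻¹) := by rw [hu]; ring
      _ = noiseConst d C ζ * (D * (√u + u) + u) * (1 / 2 * e + (n : ℝ)⁻¹) := by rw [hid]
      _ ≤ noiseConst d C ζ * ((4 * k + 2 * d + 1) * (b + u)) * (e + (n : ℝ)⁻¹) := by
        gcongr <;> linarith
      _ = _ := by ring
  rw [lowerConst, ← hk]
  set Q := noiseConst d C ζ *
      (D * (√(I.card * Real.log n) + Real.log n) + Real.log n) * (1 / 2 * e + (n : ℝ)⁻¹)
  rw [empNoise_eq, empNoise_eq] at nx ny
  have hsum : ∑ i ∈ I, ℓ i m - ∑ i ∈ I, ψ i m -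
      (1 / 2 * (∑ i ∈ I, ℓ i x - ∑ i ∈ I, ψ i x) + 1 / 2 * (∑ i ∈ I, ℓ i y - ∑ i ∈ I, ψ i y)) ≤ Q := by
    linarith
  have hsum' := mul_le_mul_of_nonneg_left hsum (by positivity : 0 ≤ (I.card : ℝ)⁻¹)
  have hym' := mul_le_mul_of_nonneg_left hym (by positivity : 0 ≤ (I.card : ℝ)⁻¹)
  have e1 : (I.card : ℝ)⁻¹ * (∑ i ∈ I, ℓ i m - ∑ i ∈ I, ψ i m -
      (1 / 2 * (∑ i ∈ I, ℓ i x - ∑ i ∈ I, ψ i x) + 1 / 2 * (∑ i ∈ I, ℓ i y - ∑ i ∈ I, ψ i y))) =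
      (I.card : ℝ)⁻¹ * ∑ i ∈ I, ℓ i m - (I.card : ℝ)⁻¹ * ∑ i ∈ I, ψ i m -
      (1 / 2 * ((I.card : ℝ)⁻¹ * ∑ i ∈ I, ℓ i x) - 1 / 2 * ((I.card : ℝ)⁻¹ * ∑ i ∈ I, ψ i x) +
      1 / 2 * ((I.card : ℝ)⁻¹ * ∑ i ∈ I, ℓ i y) - 1 / 2 * ((I.card : ℝ)⁻¹ * ∑ i ∈ I, ψ i y)) := by
    ring
  rw [e1] at hsum'
  rw [mul_sub]
  linarith

/-- The excess loss over `I` of an empirical minimizer over `R ⊆ I`. -/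
theorem excess_le_sq (h : EmpiricalControl Θ N n d C ζ ρ ℓ ψ g γ θ₀)
    (hr₀ : 0 < r₀) (hr₁ : r₀ ≤ 1) (hR : IsInterval n R) (hI : IsInterval n I) (hRI : R ⊆ I)
    (hcov : r₀ * I.card ≤ R.card) (hx : x ∈ Θ) (hxR : ∀ v ∈ Θ, ∑ i ∈ R, ℓ i x ≤ ∑ i ∈ R, ℓ i v)
    (hy : y ∈ Θ) (hyI : ∀ v ∈ Θ, ∑ i ∈ I, ℓ i y ≤ ∑ i ∈ I, ℓ i v) :
    (I.card : ℝ)⁻¹ * (∑ i ∈ I, ℓ i x - ∑ i ∈ I, ℓ i y) ≤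
      excessConst d C ζ ρ r₀ * (‖(I.card : ℝ)⁻¹ • ∑ i ∈ I \ R, γ i (θ₀ R)‖ ^ 2 +
        (I \ R).card / I.card * (Real.log n / I.card) + (Real.log n / I.card) ^ 2) := by
  have hcI : (0 : ℝ) < I.card := by exact_mod_cast hI.card_pos
  have hL := h.log_pos
  have hρ := h.modulus_pos
  obtain ⟨-, hU, hW, -⟩ :=
    excess_consts_pos h.diam_nonneg h.const_nonneg h.lip_nonneg h.modulus_pos hr₀
  have hup := h.excess_le hr₀ hr₁ hR hI hRI hcov hx hxR hy
  have hlo := h.le_excess hr₀ hr₁ hR hI hRI hcov hx hxR hy hyI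
  have hn := h.inv_le_two_mul hI
  rw [excessConst]
  set u := Real.log n / I.card
  have hu0 : 0 < u := by positivity
  set w := ((I \ R).card : ℝ) / I.card * u
  have hw0 : 0 ≤ w := by positivity
  set b := ‖(I.card : ℝ)⁻¹ • ∑ i ∈ I \ R, γ i (θ₀ R)‖
  have hb0 : 0 ≤ b := norm_nonneg _
  have hs0 : 0 ≤ √w := Real.sqrt_nonneg _
  set U := upperConst d C ζ ρ r₀
  set W := lowerConst d C ζ ρ r₀
  set e := ‖x - y‖
  have he0 : 0 ≤ e := norm_nonneg _
  -- Both inequalities are weakened to the common rate G, with 1/n ≤ 2G; then e is at most a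
  -- multiple of G and the excess at most a multiple of G².
  set G := b + √w + u with hG
  have hG0 : 0 < G := by positivity
  have hnG : (n : ℝ)⁻¹ ≤ 2 * G := hn.trans (by linarith)
  have hup' : (I.card : ℝ)⁻¹ * (∑ i ∈ I, ℓ i x - ∑ i ∈ I, ℓ i y) ≤ U * G * (e + 2 * G) := by
    refine hup.trans ?_
    gcongr
  have hlo' : W * (b + u) * (e + (n : ℝ)⁻¹) ≤ W * G * (e + 2 * G) := by
    gcongr
    linarith
  have hsq : e ^ 2 ≤ 4 / ρ * (U + W) * G * (e + 2 * G) := by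
    calc e ^ 2 = 4 / ρ * (ρ / 4 * e ^ 2) := by field_simp
      _ ≤ 4 / ρ * (U * G * (e + 2 * G) + W * G * (e + 2 * G)) := by gcongr; linarith
      _ = _ := by ring
  have heG := le_of_sq_le_mul_add hG0 (by positivity) hsq
  have hGsq : G ^ 2 ≤ 3 * (b ^ 2 + w + u ^ 2) := by
    have := Real.sq_sqrt hw0
    nlinarith [sq_nonneg (b - √w), sq_nonneg (b - u), sq_nonneg (√w - u)]
  set k := 4 / ρ * (U + W) + 2
  have hk : 0 < k := by positivity
  calc _ ≤ _ := hup'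
    _ ≤ U * G * (k * G + 2 * G) := by gcongr
    _ = U * (k + 2) * G ^ 2 := by ring
    _ ≤ U * (k + 2) * (3 * (b ^ 2 + w + u ^ 2)) := by gcongr
    _ = _ := by ring

end EmpiricalControl

end ExcessLoss

/-! ### The event on which the empirical process is controlled -/

/-- The size of `g` at x is unknown, so ℓ x cannot be bounded above by one subgradient inequality.
Nets of mesh n⁻ᵐ approach x; the linear growth in m of the subgradient bounds is summable against
the mesh. -/
theorem abs_sub_le_of_chaining {E : Type*} [NormedAddCommGroup E] [InnerProductSpace ℝ E]
    {Θ : Set E} {n : ℕ} (hn : 2 ≤ n) {κ : ℝ} (hκ : 0 ≤ κ) {ℓ : E → ℝ} {g : E → E}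
    (hsub : ∀ x ∈ Θ, ∀ y ∈ Θ, ℓ x + ⟪g x, y - x⟫_ℝ ≤ ℓ y) {x : E} (hx : x ∈ Θ) {q : ℕ → E}
    (hq : ∀ m, q m ∈ Θ) (hxq : ∀ m, ‖x - q m‖ ≤ ((n : ℝ) ^ m)⁻¹)
    (hg : ∀ m, 3 ≤ m → ‖g (q m)‖ ≤ κ * (m + 1)) :
    |ℓ x - ℓ (q 3)| ≤ 24 * κ * ((n : ℝ) ^ 3)⁻¹ := by
  have hn2 : (2 : ℝ) ≤ n := by exact_mod_cast hn
  have hn0 : (0 : ℝ) < n := by linarith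
  set δ := ((n : ℝ) ^ 3)⁻¹ with hδ
  have hδ0 : 0 < δ := by positivity
  have hpow : ∀ j : ℕ, ((n : ℝ) ^ (3 + j))⁻¹ ≤ δ * (1 / 2) ^ j := fun j => by
    rw [pow_add, mul_inv, one_div, inv_pow]
    gcongr
  -- The bracket is the closed form of the partial sums of (j + 5)/2ʲ, whose limit 12 yields the
  -- constant 24.
  have hstep : ∀ J : ℕ, ℓ (q (3 + J)) ≤
      ℓ (q 3) + 2 * κ * δ * (12 - (2 * J + 12) * (1 / 2) ^ J) := by
    intro J
    induction J with
    | zero => simp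
    | succ J ih =>
      have h1 := hsub _ (hq (3 + (J + 1))) _ (hq (3 + J))
      have h2 : ‖q (3 + J) - q (3 + (J + 1))‖ ≤ 2 * (δ * (1 / 2) ^ J) := by
        have e1 := (hxq (3 + J)).trans (hpow J)
        have e2 := (hxq (3 + (J + 1))).trans (hpow (J + 1))
        have e3 : δ * (1 / 2) ^ (J + 1) ≤ δ * (1 / 2 : ℝ) ^ J := by
          rw [pow_succ]
          have : 0 < δ * (1 / 2 : ℝ) ^ J := by positivity
          linarith
        have e4 : q (3 + J) - q (3 + (J + 1)) = (x - q (3 + (J + 1))) - (x - q (3 + J)) := by abel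
        rw [e4]
        exact (norm_sub_le _ _).trans (by linarith)
      have h3 := hg (3 + (J + 1)) (by omega)
      have h4 : -(κ * (J + 5) * (2 * (δ * (1 / 2) ^ J))) ≤
          ⟪g (q (3 + (J + 1))), q (3 + J) - q (3 + (J + 1))⟫_ℝ := by
        refine (abs_le.1 ((abs_real_inner_le_norm _ _).trans ?_)).1
        refine mul_le_mul (h3.trans ?_) h2 (norm_nonneg _) (by positivity)
        push_cast
        gcongr ?_ * ?_
        linarith
      have h5 : 2 * κ * δ * (12 - (2 * (J + 1 : ℕ) + 12) * (1 / 2) ^ (J + 1)) =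
          2 * κ * δ * (12 - (2 * J + 12) * (1 / 2) ^ J) + κ * (J + 5) * (2 * (δ * (1 / 2) ^ J)) := by
        push_cast
        ring
      rw [h5]
      linarith
  -- The uncontrolled but finite ‖g x‖ is multiplied by a distance tending to 0.
  have hlim : Filter.Tendsto (fun J : ℕ => ℓ (q 3) + 24 * κ * δ + ‖g x‖ * (δ * (1 / 2) ^ J))
      Filter.atTop (𝓝 (ℓ (q 3) + 24 * κ * δ + ‖g x‖ * (δ * 0))) :=
    (((tendsto_pow_atTop_nhds_zero_of_lt_one (by norm_num) (by norm_num)).const_mul δ).const_mul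
      ‖g x‖).const_add _
  have hup : ℓ x ≤ ℓ (q 3) + 24 * κ * δ + ‖g x‖ * (δ * 0) := by
    refine ge_of_tendsto' hlim fun J => ?_
    have h1 := hsub x hx _ (hq (3 + J))
    have h2 : -(‖g x‖ * (δ * (1 / 2) ^ J)) ≤ ⟪g x, q (3 + J) - x⟫_ℝ := by
      refine (abs_le.1 ((abs_real_inner_le_norm _ _).trans ?_)).1
      rw [norm_sub_rev]
      gcongr
      exact (hxq _).trans (hpow J)
    have h3 : 0 ≤ 2 * κ * δ * ((2 * J + 12) * (1 / 2) ^ J) := by positivity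
    have h4 := hstep J
    linarith
  have hlo : ℓ (q 3) - 24 * κ * δ ≤ ℓ x := by
    have h1 := hsub _ (hq 3) x hx
    have h2 : -(κ * 4 * δ) ≤ ⟪g (q 3), x - q 3⟫_ℝ := by
      refine (abs_le.1 ((abs_real_inner_le_norm _ _).trans ?_)).1
      have h3 := hg 3 le_rfl
      norm_num at h3
      exact mul_le_mul h3 (hxq 3) (norm_nonneg _) (by positivity)
    have h4 : 0 ≤ κ * δ := by positivity
    linarith
  rw [abs_le]
  constructor <;> linarith

/-- The numerical factor 2p is absorbed through 2p ≤ n^(2p), so the count, the prefactor and the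
target rate only compete through exponents of n. -/
theorem measure_biUnion_finset_le_inv_pow {Ω ι : Type*} [MeasurableSpace Ω] {μ : Measure Ω}
    {F : Finset ι} {B : ι → Set Ω} {n p A K k : ℕ} (hn : 2 ≤ n) (hF : F.card ≤ n ^ A)
    (hK : A + 2 * p + k ≤ K)
    (hB : ∀ a ∈ F, μ (B a) ≤ p * ENNReal.ofReal (2 * Real.exp (-(K * Real.log n)))) :
    μ (⋃ a ∈ F, B a) ≤ ENNReal.ofReal (((n : ℝ) ^ k)⁻¹) := by
  have hn0 : (0 : ℝ) < n := by positivity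
  have hn1 : (1 : ℝ) ≤ n := by exact_mod_cast (by omega : 1 ≤ n)
  have hexp : Real.exp (-(K * Real.log n)) = ((n : ℝ) ^ K)⁻¹ := by
    rw [Real.exp_neg, Real.exp_nat_mul, Real.exp_log hn0]
  have h2p : (2 * p : ℝ) ≤ (n : ℝ) ^ (2 * p) := by
    exact_mod_cast (Nat.lt_pow_self hn (n := 2 * p)).le
  have hF' : (F.card : ℝ) ≤ (n : ℝ) ^ A := by exact_mod_cast hF
  calc μ (⋃ a ∈ F, B a) ≤ ∑ a ∈ F, μ (B a) := measure_biUnion_finset_le _ _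
    _ ≤ ∑ _a ∈ F, p * ENNReal.ofReal (2 * Real.exp (-(K * Real.log n))) :=
        Finset.sum_le_sum hB
    _ = ENNReal.ofReal (F.card * (p * (2 * ((n : ℝ) ^ K)⁻¹))) := by
        rw [Finset.sum_const, nsmul_eq_mul, hexp, ENNReal.ofReal_mul (by positivity),
          ENNReal.ofReal_mul (by positivity), ENNReal.ofReal_mul (by positivity),
          ENNReal.ofReal_mul (by positivity), ENNReal.ofReal_natCast, ENNReal.ofReal_natCast]
    _ ≤ _ := by
        apply ENNReal.ofReal_le_ofReal
        rw [← div_eq_mul_inv 2, ← mul_div_assoc, ← mul_div_assoc, div_le_iff₀ (by positivity)]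
        calc F.card * ((p : ℝ) * 2) = F.card * (2 * p) := by ring
          _ ≤ (n : ℝ) ^ A * (n : ℝ) ^ (2 * p) := by gcongr
          _ = ((n : ℝ) ^ k)⁻¹ * (n : ℝ) ^ (A + 2 * p + k) := by
            rw [pow_add _ _ k, pow_add]; field_simp
          _ ≤ _ := by gcongr

open Classical in
/-- The finite set of all intervals in `(0, n]`. -/
noncomputable def intervals (n : ℕ) : Finset (Finset ℕ) :=
  (Finset.Ioc 0 n).powerset.filter (IsInterval n)

theorem mem_intervals {n : ℕ} {S : Finset ℕ} : S ∈ intervals n ↔ IsInterval n S := by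
  classical
  rw [intervals, Finset.mem_filter, Finset.mem_powerset]
  exact ⟨And.right, fun h => ⟨h.subset, h⟩⟩

theorem card_intervals_le {n : ℕ} (hn : 2 ≤ n) : (intervals n).card ≤ n ^ 4 := by
  classical
  have h1 : intervals n ⊆ (Finset.range (n + 1) ×ˢ Finset.range (n + 1)).image
      fun a => Finset.Ioc a.1 a.2 := by
    intro S hS
    obtain ⟨s, e, hse, hen, rfl⟩ := mem_intervals.1 hS
    exact Finset.mem_image.2 ⟨(s, e), by simp only [Finset.mem_product, Finset.mem_range]; omega, rfl⟩
  refine (Finset.card_le_card h1).trans (Finset.card_image_le.trans ?_)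
  rw [Finset.card_product, Finset.card_range]
  have : n + 1 ≤ n ^ 2 := by nlinarith
  calc (n + 1) * (n + 1) ≤ n ^ 2 * n ^ 2 := Nat.mul_le_mul this this
    _ = n ^ 4 := by ring

theorem isInterval_singleton {n i : ℕ} (hi : i ∈ Finset.Ioc 0 n) : IsInterval n {i} := by
  rw [Finset.mem_Ioc] at hi
  refine ⟨i - 1, i, by omega, hi.2, ?_⟩
  ext j
  rw [Finset.mem_singleton, Finset.mem_Ioc]
  omega

section Event

variable {Ω : Type*} [MeasurableSpace Ω] {Z : Type*} [MeasurableSpace Z] {p : ℕ}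
  {Θ : Set (EuclideanSpace ℝ (Fin p))} {r₀ c₁ c₂ c₃ c₄ c₅ ρ ζ Δ : ℝ} {n : ℕ} {μ : Measure Ω}
  {z : ℕ → Ω → Z} {ℓ : Z → EuclideanSpace ℝ (Fin p) → ℝ}
  {g : Z → EuclideanSpace ℝ (Fin p) → EuclideanSpace ℝ (Fin p)}
  {θ₀ : Finset ℕ → EuclideanSpace ℝ (Fin p)}

namespace MEstConditions

theorem center_mem (h : MEstConditions Θ r₀ c₁ c₂ c₃ c₄ c₅ ρ ζ Δ n μ z ℓ g θ₀) {S : Finset ℕ}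
    (hS : IsInterval n S) :
    θ₀ S ∈ Θ ∧ ∀ x ∈ Θ, popLoss μ z ℓ S (θ₀ S) ≤ popLoss μ z ℓ S x := by
  have : θ₀ S ∈ argminSet Θ (popLoss μ z ℓ S) := by rw [h.argmin_pop S hS]; rfl
  exact this

theorem measurable_score (h : MEstConditions Θ r₀ c₁ c₂ c₃ c₄ c₅ ρ ζ Δ n μ z ℓ g θ₀) {i : ℕ}
    (hi : i ∈ Finset.Ioc 0 n) {x : EuclideanSpace ℝ (Fin p)} (hx : x ∈ Θ) :
    Measurable fun ω => g (z i ω) x :=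
  (h.measurable_grad x hx).comp (h.measurable_obs i hi)

/-- Each score is its value at the minimizer of its own index plus an increment over a distance of
at most d. The +1 supplies the strictness required by `SubExpVec.of_psiOneNormVec_le`. -/
theorem subExpVec_score (h : MEstConditions Θ r₀ c₁ c₂ c₃ c₄ c₅ ρ ζ Δ n μ z ℓ g θ₀)
    {d : ℝ} (hd : 0 ≤ d) (hdΘ : ∀ x ∈ Θ, ∀ y ∈ Θ, ‖x - y‖ ≤ d) (hc₁ : 0 < c₁) (hc₃ : 0 < c₃)
    {i : ℕ} (hi : i ∈ Finset.Ioc 0 n) {x : EuclideanSpace ℝ (Fin p)} (hx : x ∈ Θ) :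
    SubExpVec μ (fun ω => g (z i ω) x) (2 * (c₁ + c₃ * d + 1)) := by
  have hS := isInterval_singleton hi
  have hc := (h.center_mem hS).1
  have hb : 0 < c₁ + c₃ * d + 1 := by positivity
  have h1 : SubExpVec μ (fun ω => g (z i ω) (θ₀ {i})) (c₁ + c₃ * d + 1) :=
    .of_psiOneNormVec_le ((h.subexp_grad _ hS).self_of_nhds i (Finset.mem_singleton_self i))
      (by have : 0 ≤ c₃ * d := by positivity
          linarith) hb
  have h2 : SubExpVec μ (fun ω => g (z i ω) x - g (z i ω) (θ₀ {i})) (c₁ + c₃ * d + 1) :=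
    .of_psiOneNormVec_le (h.subexp_increment _ hS i (Finset.mem_singleton_self i) x hx)
      (by have : c₃ * ‖x - θ₀ {i}‖ ≤ c₃ * d := by gcongr; exact hdΘ x hx _ hc
          linarith) hb
  have h3 := h1.add h2 (h.measurable_score hi hc) hb
  simpa only [add_sub_cancel] using h3

theorem subExpVec_increment (h : MEstConditions Θ r₀ c₁ c₂ c₃ c₄ c₅ ρ ζ Δ n μ z ℓ g θ₀)
    (hc₃ : 0 < c₃) {S : Finset ℕ} (hS : IsInterval n S) {i : ℕ} (hi : i ∈ S)
    {x : EuclideanSpace ℝ (Fin p)} (hx : x ∈ Θ) (hne : x ≠ θ₀ S) :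
    SubExpVec μ (fun ω => g (z i ω) x - g (z i ω) (θ₀ S)) (2 * c₃ * ‖x - θ₀ S‖) := by
  have h0 : 0 < ‖x - θ₀ S‖ := norm_pos_iff.2 (sub_ne_zero.2 hne)
  have h1 : 0 < c₃ * ‖x - θ₀ S‖ := by positivity
  exact .of_psiOneNormVec_le (h.subexp_increment S hS i hi x hx) (by linarith) (by linarith)

/-- The expansion at θ = θ₀ S itself has zero right-hand side, so no differentiation under the
integral is needed. -/
theorem sum_mean_score_center (h : MEstConditions Θ r₀ c₁ c₂ c₃ c₄ c₅ ρ ζ Δ n μ z ℓ g θ₀)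
    {S : Finset ℕ} (hS : IsInterval n S) : ∑ i ∈ S, ∫ ω, g (z i ω) (θ₀ S) ∂μ = 0 := by
  have h1 := h.expansion S hS _ (h.center_mem hS).1
  have hc : (S.card : ℝ) ≠ 0 := by exact_mod_cast hS.card_pos.ne'
  simp only [sub_self, smul_zero, popScore, add_zero, map_zero, sub_zero, norm_zero, ne_eq,
    OfNat.ofNat_ne_zero, not_false_eq_true, zero_pow, mul_zero, norm_le_zero_iff, smul_eq_zero,
    inv_eq_zero, hc, false_or] at h1
  exact h1

theorem subgradient_mean (h : MEstConditions Θ r₀ c₁ c₂ c₃ c₄ c₅ ρ ζ Δ n μ z ℓ g θ₀) {i : ℕ}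
    (hi : i ∈ Finset.Ioc 0 n) (hint : ∀ x ∈ Θ, Integrable (fun ω => g (z i ω) x) μ)
    {x y : EuclideanSpace ℝ (Fin p)} (hx : x ∈ Θ) (hy : y ∈ Θ) :
    ∫ ω, ℓ (z i ω) x ∂μ + ⟪∫ ω, g (z i ω) x ∂μ, y - x⟫_ℝ ≤ ∫ ω, ℓ (z i ω) y ∂μ := by
  have h1 : Integrable (fun ω => ⟪y - x, g (z i ω) x⟫_ℝ) μ := (hint x hx).const_inner _
  rw [real_inner_comm, ← integral_inner (hint x hx),
    ← integral_add (h.integrable_loss i hi x hx) h1]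
  refine integral_mono ((h.integrable_loss i hi x hx).add h1) (h.integrable_loss i hi y hy)
    fun ω => ?_
  have := h.subgradient (z i ω) x hx y hy
  rwa [real_inner_comm] at this

/-- The deviation constant of the empirical process; `b` is the exponent of the net sizes. -/
noncomputable def deviationConst (p b : ℕ) (c₁ c₃ d : ℝ) : ℝ :=
  34 * (4 * b + 2 * p + 7) * (p * (2 * (c₁ + c₃ * d + 1) + 2 * c₃))

theorem exists_measurableSet_empiricalControl [IsProbabilityMeasure μ]
    (h : MEstConditions Θ r₀ c₁ c₂ c₃ c₄ c₅ ρ ζ Δ n μ z ℓ g θ₀)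
    {d : ℝ} (hd : 0 ≤ d) (hdΘ : ∀ x ∈ Θ, ∀ y ∈ Θ, ‖x - y‖ ≤ d) (hc₁ : 0 < c₁) (hc₃ : 0 < c₃)
    (hρ : 0 < ρ) (hζ : 0 < ζ) (hn : 2 ≤ n) {b : ℕ} {N : ℕ → Finset (EuclideanSpace ℝ (Fin p))}
    (hNΘ : ∀ m, ∀ q ∈ N m, q ∈ Θ)
    (hN : ∀ m, ∀ x ∈ Θ, ∃ q ∈ N m, ‖x - q‖ ≤ ((n : ℝ) ^ m)⁻¹)
    (hNcard : ∀ m, (N m).card ≤ n ^ (b * (m + 1))) :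
    ∃ A : Set Ω, MeasurableSet A ∧ 1 - (n : ℝ)⁻¹ ≤ μ.real A ∧ ∀ ω ∈ A,
      EmpiricalControl Θ (N 3) n d (deviationConst p b c₁ c₃ d) ζ ρ (fun i => ℓ (z i ω))
        (fun i x => ∫ ω', ℓ (z i ω') x ∂μ) (fun i => g (z i ω))
        (fun i x => ∫ ω', g (z i ω') x ∂μ) θ₀ := by
  classical
  set β : ℝ := 2 * (c₁ + c₃ * d + 1) with hβ
  have hβ0 : 0 < β := by positivity
  -- Exponents add up: 4 for intervals, 4b for the net of mesh n⁻³, 2p for the prefactor, 3 for the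
  -- remaining rate n⁻³.
  set κ : ℕ := 4 * b + 2 * p + 7 with hκ
  set L := Real.log n with hL
  have hn2 : (2 : ℝ) ≤ n := by exact_mod_cast hn
  have hn0 : (0 : ℝ) < n := by linarith
  have hL0 : 0 < L := Real.log_pos (by linarith)
  have hsc : ∀ i ∈ Finset.Ioc 0 n, ∀ x ∈ Θ, SubExpVec μ (fun ω => g (z i ω) x) β :=
    fun i hi x hx => h.subExpVec_score hd hdΘ hc₁ hc₃ hi hx
  have hint : ∀ i ∈ Finset.Ioc 0 n, ∀ x ∈ Θ, Integrable (fun ω => g (z i ω) x) μ :=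
    fun i hi x hx => (hsc i hi x hx).integrable (h.measurable_score hi hx) hβ0
  -- Large scores at mesh n⁻ᵐ: the threshold grows with m to beat the net size n^(b(m+1)) and keep
  -- the probabilities summable. B₂ and B₃ are large deviations of scores and of their increments
  -- over intervals.
  set B₁ : ℕ → ℕ × EuclideanSpace ℝ (Fin p) → Set Ω := fun m a =>
    {ω | p * (β * ((κ * (m + 1) : ℕ) * L)) < ‖g (z a.1 ω) a.2‖} with hB₁
  set B₂ : Finset ℕ × EuclideanSpace ℝ (Fin p) → Set Ω := fun a =>
    {ω | p * (β * (34 * (√(a.1.card * (κ * L)) + κ * L))) <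
      ‖∑ i ∈ a.1, (g (z i ω) a.2 - ∫ ω', g (z i ω') a.2 ∂μ)‖} with hB₂
  set B₃ : Finset ℕ × EuclideanSpace ℝ (Fin p) → Set Ω := fun a =>
    {ω | p * (2 * c₃ * ‖a.2 - θ₀ a.1‖ * (34 * (√(a.1.card * (κ * L)) + κ * L))) <
      ‖∑ i ∈ a.1, ((g (z i ω) a.2 - g (z i ω) (θ₀ a.1)) -
        ∫ ω', (g (z i ω') a.2 - g (z i ω') (θ₀ a.1)) ∂μ)‖} with hB₃
  have hκL : 0 < (κ : ℝ) * L := by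
    have : (0 : ℝ) < κ := by rw [hκ]; positivity
    positivity
  have m₁ : ∀ j : ℕ, μ (⋃ a ∈ Finset.Ioc 0 n ×ˢ N (j + 3), B₁ (j + 3) a) ≤
      ENNReal.ofReal ((4 * n : ℝ)⁻¹ * (1 / 2) ^ j) := by
    intro j
    have hcard : (Finset.Ioc 0 n ×ˢ N (j + 3)).card ≤ n ^ (1 + b * (j + 3 + 1)) := by
      rw [Finset.card_product, Nat.card_Ioc, Nat.sub_zero, pow_add, pow_one]
      exact Nat.mul_le_mul_left n (hNcard _)
    refine (measure_biUnion_finset_le_inv_pow (p := p) (k := j + 3) (K := κ * (j + 3 + 1)) hn hcard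
      (by rw [hκ]; nlinarith) ?_).trans ?_
    · rintro ⟨i, q⟩ ha
      obtain ⟨hi, hq⟩ := Finset.mem_product.1 ha
      exact (hsc i hi q (hNΘ _ q hq)).measure_lt_norm_le
        (h.measurable_score hi (hNΘ _ q hq)) hβ0 _
    · apply ENNReal.ofReal_le_ofReal
      rw [one_div, inv_pow, ← mul_inv]
      apply inv_anti₀ (by positivity)
      have e1 : (2 : ℝ) ^ j ≤ (n : ℝ) ^ j := by gcongr
      calc 4 * (n : ℝ) * 2 ^ j ≤ n ^ 2 * n * n ^ j := by gcongr; nlinarith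
        _ = _ := by ring
  have hcard : (intervals n ×ˢ N 3).card ≤ n ^ (4 + b * (3 + 1)) := by
    rw [Finset.card_product, pow_add]
    exact Nat.mul_le_mul (card_intervals_le hn) (hNcard 3)
  have hn3 : ENNReal.ofReal (((n : ℝ) ^ 3)⁻¹) ≤ ENNReal.ofReal ((4 * n : ℝ)⁻¹) := by
    apply ENNReal.ofReal_le_ofReal
    apply inv_anti₀ (by positivity)
    have : (4 : ℝ) ≤ n ^ 2 := by nlinarith
    nlinarith
  have m₂ : μ (⋃ a ∈ intervals n ×ˢ N 3, B₂ a) ≤ ENNReal.ofReal ((4 * n : ℝ)⁻¹) := by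
    refine (measure_biUnion_finset_le_inv_pow (p := p) (k := 3) (K := κ) hn hcard
      (by rw [hκ]; omega) ?_).trans hn3
    rintro ⟨S, q⟩ ha
    obtain ⟨hS, hq⟩ := Finset.mem_product.1 ha
    have hS' := mem_intervals.1 hS
    have hqΘ := hNΘ _ q hq
    exact measure_lt_norm_sum_centered_le hS'.subset h.indep_obs h.measurable_obs
      (h.measurable_grad q hqΘ) hβ0 (fun i hi => hsc i (hS'.subset hi) q hqΘ) hκL
  have m₃ : μ (⋃ a ∈ intervals n ×ˢ N 3, B₃ a) ≤ ENNReal.ofReal ((4 * n : ℝ)⁻¹) := by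
    refine (measure_biUnion_finset_le_inv_pow (p := p) (k := 3) (K := κ) hn hcard
      (by rw [hκ]; omega) ?_).trans hn3
    rintro ⟨S, q⟩ ha
    obtain ⟨hS, hq⟩ := Finset.mem_product.1 ha
    have hS' := mem_intervals.1 hS
    have hqΘ := hNΘ _ q hq
    -- At the centre the increment vanishes and the scale would be 0, so Bernstein's inequality does
    -- not apply; the bad set is then empty.
    by_cases hne : q = θ₀ S
    · simp [hB₃, hne]
    · have h0 : 0 < ‖q - θ₀ S‖ := norm_pos_iff.2 (sub_ne_zero.2 hne)
      exact measure_lt_norm_sum_centered_le (f := fun x => g x q - g x (θ₀ S)) hS'.subset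
        h.indep_obs h.measurable_obs
        ((h.measurable_grad q hqΘ).sub (h.measurable_grad _ (h.center_mem hS').1)) (by positivity)
        (fun i hi => h.subExpVec_increment hc₃ hS' hi hqΘ hne) hκL
  -- The three families have probabilities at most 2/(4n), 1/(4n) and 1/(4n).
  set B : Set Ω := (⋃ j : ℕ, ⋃ a ∈ Finset.Ioc 0 n ×ˢ N (j + 3), B₁ (j + 3) a) ∪
    ((⋃ a ∈ intervals n ×ˢ N 3, B₂ a) ∪ ⋃ a ∈ intervals n ×ˢ N 3, B₃ a) with hBdef
  have hμB : μ B ≤ ENNReal.ofReal ((n : ℝ)⁻¹) := by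
    have hsum : μ (⋃ j : ℕ, ⋃ a ∈ Finset.Ioc 0 n ×ˢ N (j + 3), B₁ (j + 3) a) ≤
        ENNReal.ofReal ((4 * n : ℝ)⁻¹ * 2) := by
      refine (measure_iUnion_le _).trans ((ENNReal.tsum_le_tsum m₁).trans ?_)
      rw [← ENNReal.ofReal_tsum_of_nonneg (fun j => by positivity)
        (summable_geometric_two.mul_left _), tsum_mul_left, tsum_geometric_two]
    refine (measure_union_le _ _).trans ((add_le_add hsum ((measure_union_le _ _).trans
      (add_le_add m₂ m₃))).trans ?_)
    rw [← ENNReal.ofReal_add (by positivity) (by positivity),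
      ← ENNReal.ofReal_add (by positivity) (by positivity)]
    apply ENNReal.ofReal_le_ofReal
    rw [mul_inv]
    linarith
  -- Passing to a measurable hull spares checking that the bad sets are measurable.
  refine ⟨(toMeasurable μ B)ᶜ, (measurableSet_toMeasurable μ B).compl, ?_, ?_⟩
  · rw [measureReal_compl (measurableSet_toMeasurable μ B), probReal_univ]
    have : μ.real (toMeasurable μ B) ≤ (n : ℝ)⁻¹ := by
      rw [Measure.real, measure_toMeasurable]
      exact ENNReal.toReal_le_of_le_ofReal (by positivity) hμB
    linarith
  intro ω hω
  have hωB : ω ∉ B := fun hcon => hω (subset_toMeasurable μ B hcon)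
  simp only [hBdef, Set.mem_union, Set.mem_iUnion, not_or, not_exists] at hωB
  obtain ⟨n₁, n₂, n₃⟩ := hωB
  have g₁ : ∀ j : ℕ, ∀ i ∈ Finset.Ioc 0 n, ∀ q ∈ N (j + 3),
      ‖g (z i ω) q‖ ≤ p * (β * ((κ * (j + 3 + 1) : ℕ) * L)) := fun j i hi q hq =>
    not_lt.1 (n₁ j (i, q) (Finset.mem_product.2 ⟨hi, hq⟩))
  have hsqrt : ∀ S : Finset ℕ, √(S.card * (κ * L)) + κ * L ≤ κ * (√(S.card * L) + L) := by
    intro S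
    have e1 : (1 : ℝ) ≤ κ := by exact_mod_cast (by omega : 1 ≤ κ)
    have e2 : √(S.card * (κ * L)) ≤ κ * √(S.card * L) := by
      rw [show S.card * (κ * L) = κ * (S.card * L) by ring, Real.sqrt_mul (by positivity)]
      gcongr
      exact Real.sqrt_le_iff.2 ⟨by positivity, by nlinarith⟩
    linarith
  have hκ1 : (1 : ℝ) ≤ κ := by exact_mod_cast (by omega : 1 ≤ κ)
  have hCdef : deviationConst p b c₁ c₃ d = 34 * κ * (p * (β + 2 * c₃)) := by
    rw [deviationConst, hκ, hβ]; push_cast; ring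
  set C := deviationConst p b c₁ c₃ d
  have hC0 : 0 ≤ C := by rw [hCdef]; positivity
  have hCβ : 34 * κ * (p * β) ≤ C := by
    rw [hCdef]
    gcongr
    linarith
  have hpβκ : 0 ≤ κ * (p * β) := by positivity
  exact {
    two_le := hn
    diam_nonneg := hd
    const_nonneg := hC0
    lip_nonneg := hζ.le
    modulus_pos := hρ
    convex := h.convex
    norm_sub_le_diam := hdΘ
    net_subset := hNΘ 3
    subgradient := fun i _ x hx y hy => h.subgradient (z i ω) x hx y hy
    subgradient_mean := fun i hi x hx y hy => h.subgradient_mean hi (hint i hi) hx hy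
    lipschitz_mean := h.lipschitz_grad
    norm_mean_le := fun i hi x hx => by
      refine ((hsc i hi x hx).norm_integral_le (h.measurable_score hi hx) hβ0).trans ?_
      have : 1 * (p * β) ≤ κ * (p * β) := by gcongr
      linarith
    norm_grad_le := fun i hi q hq => by
      refine (g₁ 0 i hi q hq).trans ?_
      push_cast
      calc _ = 4 * (κ * (p * β)) * L := by ring
        _ ≤ C * L := by gcongr; linarith
    exists_net := fun x hx => by
      choose q hqN hq using fun m => hN m x hx
      refine ⟨q 3, hqN 3, hq 3, fun i hi => ?_⟩
      refine (abs_sub_le_of_chaining hn (κ := κ * (p * β) * L) (by positivity)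
        (h.subgradient (z i ω)) hx (fun m => hNΘ m _ (hqN m)) hq fun m hm => ?_).trans ?_
      · obtain ⟨j, rfl⟩ := Nat.exists_eq_add_of_le' hm
        refine (g₁ j i hi _ (hqN _)).trans (le_of_eq ?_)
        push_cast
        ring
      · refine mul_le_mul_of_nonneg_right ?_ (by positivity)
        rw [← mul_assoc]
        exact mul_le_mul_of_nonneg_right (by linarith) hL0.le
    deviation := fun S hS q hq => by
      refine (not_lt.1 (n₂ (S, q) (Finset.mem_product.2 ⟨mem_intervals.2 hS, hq⟩))).trans ?_
      calc p * (β * (34 * (√(S.card * (κ * L)) + κ * L)))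
          ≤ p * (β * (34 * (κ * (√(S.card * L) + L)))) := by gcongr; exact hsqrt S
        _ = 34 * κ * (p * β) * (√(S.card * L) + L) := by ring
        _ ≤ _ := by gcongr
    increment := fun S hS q hq => by
      have hc := (h.center_mem hS).1
      have e1 : ‖∑ i ∈ S, ((g (z i ω) q - g (z i ω) (θ₀ S)) -
            ∫ ω', (g (z i ω') q - g (z i ω') (θ₀ S)) ∂μ)‖ ≤
          p * (2 * c₃ * ‖q - θ₀ S‖ * (34 * (√(S.card * (κ * L)) + κ * L))) :=
        not_lt.1 (n₃ (S, q) (Finset.mem_product.2 ⟨mem_intervals.2 hS, hq⟩))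
      have e2 : ∑ i ∈ S, (g (z i ω) q - ∫ ω', g (z i ω') q ∂μ) -
          ∑ i ∈ S, (g (z i ω) (θ₀ S) - ∫ ω', g (z i ω') (θ₀ S) ∂μ) =
          ∑ i ∈ S, ((g (z i ω) q - g (z i ω) (θ₀ S)) -
            ∫ ω', (g (z i ω') q - g (z i ω') (θ₀ S)) ∂μ) := by
        rw [← Finset.sum_sub_distrib]
        refine Finset.sum_congr rfl fun i hi => ?_
        rw [integral_sub (hint i (hS.subset hi) q (hNΘ 3 q hq)) (hint i (hS.subset hi) _ hc)]
        abel
      rw [e2]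
      refine e1.trans ?_
      calc p * (2 * c₃ * ‖q - θ₀ S‖ * (34 * (√(S.card * (κ * L)) + κ * L)))
          ≤ p * (2 * c₃ * ‖q - θ₀ S‖ * (34 * (κ * (√(S.card * L) + L)))) := by
            gcongr; exact hsqrt S
        _ = 34 * κ * (p * (2 * c₃)) * ‖q - θ₀ S‖ * (√(S.card * L) + L) := by ring
        _ ≤ C * ‖q - θ₀ S‖ * (√(S.card * L) + L) := by
            rw [hCdef]
            gcongr
            linarith
    center_mem := fun S hS => (h.center_mem hS).1
    sum_mean_center := fun S hS => h.sum_mean_score_center hS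
    center_min := fun S hS => (h.center_mem hS).2
    strongConvex := h.strongConvex }

end MEstConditions

end Event

/-! ### The bias over nearly homogeneous intervals -/

/-- The vanishing sum over R expresses |R ∩ A| v through the few terms in R ∩ B, so v is of order
C|B|/|R|. Summing over I costs |I|/|R| ≤ 1/r₀. -/
theorem norm_sum_le_of_eq_on_majority {E : Type*} [NormedAddCommGroup E] [NormedSpace ℝ E]
    {γ : ℕ → E} {I R A B : Finset ℕ} {C r₀ : ℝ} {v : E} (hC : 0 ≤ C) (hr₀ : 0 < r₀)
    (hAB : I = A ∪ B) (hdisj : Disjoint A B) (hRI : R ⊆ I) (hR0 : 0 < R.card)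
    (hcov : r₀ * I.card ≤ R.card) (hγ : ∀ i ∈ I, ‖γ i‖ ≤ C) (hA : ∀ i ∈ A, γ i = v)
    (hR : ∑ i ∈ R, γ i = 0) : ‖∑ i ∈ I, γ i‖ ≤ C * (1 + 2 / r₀) * B.card := by
  have hR0' : (0 : ℝ) < R.card := by exact_mod_cast hR0
  have hsumB : ∀ T ⊆ B, ‖∑ i ∈ T, γ i‖ ≤ C * B.card := fun T hT => by
    calc _ ≤ ∑ _i ∈ T, C := norm_sum_le_of_le _ fun i hi =>
          hγ i (by rw [hAB]; exact Finset.mem_union_right _ (hT hi))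
      _ = C * T.card := by rw [Finset.sum_const, nsmul_eq_mul, mul_comm]
      _ ≤ _ := by gcongr
  have hI : (I.card : ℝ) ≤ R.card / r₀ := by rw [le_div_iff₀ hr₀, mul_comm]; exact hcov
  -- If B is comparable to R, then |I| itself is of order |B| and the trivial bound suffices;
  -- otherwise R ∩ A has at least half of R.
  rcases le_total (R.card : ℝ) (2 * B.card) with h | h
  · calc ‖∑ i ∈ I, γ i‖ ≤ ∑ _i ∈ I, C := norm_sum_le_of_le _ hγ
      _ = C * I.card := by rw [Finset.sum_const, nsmul_eq_mul, mul_comm]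
      _ ≤ C * (2 * B.card / r₀) := by gcongr; exact hI.trans (by gcongr)
      _ ≤ C * B.card + C * (2 * B.card / r₀) := le_add_of_nonneg_left (by positivity)
      _ = _ := by ring
  · have hRsplit : R ∩ A ∪ R ∩ B = R := by
      rw [← Finset.inter_union_distrib_left, ← hAB, Finset.inter_eq_left.2 hRI]
    have hdisjR : Disjoint (R ∩ A) (R ∩ B) :=
      hdisj.mono Finset.inter_subset_right Finset.inter_subset_right
    have hcardR : (R.card : ℝ) = (R ∩ A).card + (R ∩ B).card := by
      rw [← Nat.cast_add, ← Finset.card_union_of_disjoint hdisjR, hRsplit]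
    have hcRB : ((R ∩ B).card : ℝ) ≤ B.card := by
      exact_mod_cast Finset.card_le_card Finset.inter_subset_right
    have hsum : ∀ T ⊆ A, ∑ i ∈ T, γ i = (T.card : ℝ) • v := fun T hT => by
      rw [Finset.sum_congr rfl fun i hi => hA i (hT hi), Finset.sum_const, Nat.cast_smul_eq_nsmul]
    have hRsum := Finset.sum_union hdisjR (f := γ)
    rw [hRsplit, hR, hsum _ Finset.inter_subset_right] at hRsum
    have hv : ((R ∩ A).card : ℝ) * ‖v‖ ≤ C * B.card := by
      have : ((R ∩ A).card : ℝ) • v = -∑ i ∈ R ∩ B, γ i := eq_neg_of_add_eq_zero_left hRsum.symm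
      calc _ = ‖((R ∩ A).card : ℝ) • v‖ := by rw [norm_smul, Real.norm_of_nonneg (by positivity)]
        _ ≤ _ := by rw [this, norm_neg]; exact hsumB _ Finset.inter_subset_right
    have hv2 : (R.card : ℝ) * ‖v‖ ≤ 2 * (C * B.card) := by
      have : (R.card : ℝ) ≤ 2 * (R ∩ A).card := by linarith
      calc (R.card : ℝ) * ‖v‖ ≤ 2 * (R ∩ A).card * ‖v‖ := by gcongr
        _ ≤ _ := by linarith
    have hAI : (A.card : ℝ) ≤ I.card := by
      rw [hAB]
      exact_mod_cast Finset.card_le_card Finset.subset_union_left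
    calc ‖∑ i ∈ I, γ i‖ = ‖(A.card : ℝ) • v + ∑ i ∈ B, γ i‖ := by
          rw [hAB, Finset.sum_union hdisj, hsum A subset_rfl]
      _ ≤ A.card * ‖v‖ + C * B.card := by
          refine (norm_add_le _ _).trans (add_le_add (le_of_eq ?_) (hsumB B subset_rfl))
          rw [norm_smul, Real.norm_of_nonneg (by positivity)]
      _ ≤ R.card / r₀ * ‖v‖ + C * B.card := by gcongr; exact hAI.trans hI
      _ = R.card * ‖v‖ / r₀ + C * B.card := by ring
      _ ≤ 2 * (C * B.card) / r₀ + C * B.card := by gcongr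
      _ = _ := by ring

section Homogeneous

variable {Ω : Type*} [MeasurableSpace Ω] {Z : Type*} [MeasurableSpace Z] {μ : Measure Ω}
  {z : ℕ → Ω → Z} {n : ℕ}

theorem map_eq_map_of_forall_not_isChangepoint {s e : ℕ} (hen : e ≤ n)
    (h : ∀ τ, s < τ → τ < e → ¬ IsChangepoint μ z n τ) {i : ℕ} (hi : i ∈ Finset.Ioc s e) :
    μ.map (z i) = μ.map (z (s + 1)) := by
  obtain ⟨hsi, hie⟩ := Finset.mem_Ioc.1 hi
  clear hi
  induction i, (show s + 1 ≤ i from hsi) using Nat.le_induction with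
  | base => rfl
  | succ k hk ih =>
    have h1 := h k (by omega) (by omega)
    rw [IsChangepoint, not_and, not_and, ne_eq, not_not] at h1
    rw [← h1 (by omega) (by omega)]
    exact ih (by omega) (by omega)

/-- B is the shorter side of the changepoint. The index k is required to lie in range only when A is
non-empty: for τ = n the index τ + 1 would not. The absolute value of c covers negative c. -/
theorem NearlyHomogeneous.exists_majority {c : ℝ} {I : Finset ℕ}
    (hI : IsInterval n I) (h : NearlyHomogeneous μ z n c I) :
    ∃ (A B : Finset ℕ) (k : ℕ), I = A ∪ B ∧ Disjoint A B ∧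
      (∀ i ∈ A, k ∈ Finset.Ioc 0 n ∧ μ.map (z i) = μ.map (z k)) ∧
      (B.card : ℝ) ≤ |c| * Real.log n := by
  have hL : 0 ≤ Real.log n := Real.log_natCast_nonneg n
  have hcL : c * Real.log n ≤ |c| * Real.log n := by gcongr; exact le_abs_self c
  obtain ⟨s, e, hse, rfl, hcase⟩ := h
  have hen : e ≤ n :=
    (Finset.mem_Ioc.1 (hI.subset (Finset.mem_Ioc.2 ⟨hse, le_rfl⟩))).2
  rcases hcase with hno | ⟨τ, hτ, -, huniq, hmin⟩
  · refine ⟨Finset.Ioc s e, ∅, s + 1, by simp, by simp, fun i hi => ⟨?_, ?_⟩, ?_⟩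
    · rw [Finset.mem_Ioc]; omega
    · exact map_eq_map_of_forall_not_isChangepoint hen
        (fun τ h1 h2 => hno τ (Finset.mem_Ioc.2 ⟨h1, h2.le⟩)) hi
    · rw [Finset.card_empty, Nat.cast_zero]; positivity
  · obtain ⟨hsτ, hτe⟩ := Finset.mem_Ioc.1 hτ
    have hunion : Finset.Ioc s e = Finset.Ioc s τ ∪ Finset.Ioc τ e :=
      (Finset.Ioc_union_Ioc_eq_Ioc hsτ.le hτe).symm
    have hdisj : Disjoint (Finset.Ioc s τ) (Finset.Ioc τ e) :=
      Finset.Ioc_disjoint_Ioc_of_le le_rfl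
    have hleft : ∀ i ∈ Finset.Ioc s τ, s + 1 ∈ Finset.Ioc 0 n ∧
        μ.map (z i) = μ.map (z (s + 1)) := fun i hi =>
      ⟨by rw [Finset.mem_Ioc]; omega, map_eq_map_of_forall_not_isChangepoint (hτe.trans hen)
        (fun σ h1 h2 hσ => by
          have := huniq σ (Finset.mem_Ioc.2 ⟨h1, by omega⟩) hσ
          omega) hi⟩
    have hright : ∀ i ∈ Finset.Ioc τ e, τ + 1 ∈ Finset.Ioc 0 n ∧
        μ.map (z i) = μ.map (z (τ + 1)) := fun i hi =>
      ⟨by rw [Finset.mem_Ioc] at hi ⊢; omega, map_eq_map_of_forall_not_isChangepoint hen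
        (fun σ h1 h2 hσ => by
          have := huniq σ (Finset.mem_Ioc.2 ⟨by omega, h2.le⟩) hσ
          omega) hi⟩
    rcases min_le_iff.1 hmin with h1 | h1
    · refine ⟨Finset.Ioc τ e, Finset.Ioc s τ, τ + 1, by rw [hunion, Finset.union_comm],
        hdisj.symm, hright, ?_⟩
      rw [Nat.card_Ioc, Nat.cast_sub hsτ.le]
      linarith
    · refine ⟨Finset.Ioc s τ, Finset.Ioc τ e, s + 1, hunion, hdisj, hleft, ?_⟩
      rw [Nat.card_Ioc, Nat.cast_sub hτe]
      linarith

variable {p : ℕ} {Θ : Set (EuclideanSpace ℝ (Fin p))} {r₀ c₁ c₂ c₃ c₄ c₅ ρ ζ Δ : ℝ}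
  {ℓ : Z → EuclideanSpace ℝ (Fin p) → ℝ}
  {g : Z → EuclideanSpace ℝ (Fin p) → EuclideanSpace ℝ (Fin p)}
  {θ₀ : Finset ℕ → EuclideanSpace ℝ (Fin p)}

/-- The mean scores over R vanish at θ₀ R, so the bias is a sum over all of I, and mean scores
depend only on the law of the observation. -/
theorem MEstConditions.biasSq_le (h : MEstConditions Θ r₀ c₁ c₂ c₃ c₄ c₅ ρ ζ Δ n μ z ℓ g θ₀)
    {C c : ℝ} (hr₀ : 0 < r₀) (hC : 0 ≤ C)
    (hg : ∀ i ∈ Finset.Ioc 0 n, ∀ x ∈ Θ, ‖∫ ω, g (z i ω) x ∂μ‖ ≤ C) {R I : Finset ℕ}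
    (hcov : IsCoveredBy n r₀ R I) (hhom : NearlyHomogeneous μ z n c I) :
    biasSq μ z g I R (θ₀ R) ≤
      (C * (1 + 2 / r₀) * c) ^ 2 * (Real.log n ^ 2 / (I.card : ℝ) ^ 2) := by
  obtain ⟨hR, hI, hRI, hcard⟩ := hcov
  have hθ := (h.center_mem hR).1
  obtain ⟨A, B, k, hAB, hdisj, hA, hB⟩ := hhom.exists_majority hI
  have hAI : A ⊆ I := by rw [hAB]; exact Finset.subset_union_left
  have hz : ∀ i ∈ Finset.Ioc 0 n,
      ∫ ω, g (z i ω) (θ₀ R) ∂μ = ∫ x, g x (θ₀ R) ∂(μ.map (z i)) := fun i hi =>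
    (integral_map (h.measurable_obs i hi).aemeasurable
      (h.measurable_grad _ hθ).aestronglyMeasurable).symm
  have h1 := norm_sum_le_of_eq_on_majority (γ := fun i => ∫ ω, g (z i ω) (θ₀ R) ∂μ)
    (v := ∫ ω, g (z k ω) (θ₀ R) ∂μ) hC hr₀ hAB hdisj hRI hR.card_pos hcard
    (fun i hi => hg i (hI.subset hi) _ hθ)
    (fun i hi => by rw [hz i (hI.subset (hAI hi)), hz k (hA i hi).1, (hA i hi).2])
    (h.sum_mean_score_center hR)
  have h2 : ∑ i ∈ I \ R, ∫ ω, g (z i ω) (θ₀ R) ∂μ = ∑ i ∈ I, ∫ ω, g (z i ω) (θ₀ R) ∂μ := by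
    rw [← Finset.sum_sdiff hRI, h.sum_mean_score_center hR, add_zero]
  rw [biasSq, h2, norm_smul, Real.norm_of_nonneg (by positivity), mul_pow]
  calc _ ≤ ((I.card : ℝ)⁻¹) ^ 2 * (C * (1 + 2 / r₀) * (|c| * Real.log n)) ^ 2 := by
        gcongr
        exact h1.trans (by gcongr)
    _ = (C * (1 + 2 / r₀)) ^ 2 * |c| ^ 2 * (Real.log n ^ 2 / (I.card : ℝ) ^ 2) := by ring
    _ = _ := by rw [sq_abs, ← mul_pow]

end Homogeneous

/-! ### Choice of the constants and assembly of the three bounds. -/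

theorem theorem1 (p : ℕ) (Θ : Set (EuclideanSpace ℝ (Fin p)))
    (r₀ c₁ c₂ c₃ c₄ c₅ ρ ζ Δ : ℝ) (hr₀ : 0 < r₀) (hr₀' : r₀ < 1)
    (hc₁ : 0 < c₁) (hc₂ : 0 < c₂) (hc₃ : 0 < c₃) (hc₄ : 0 < c₄) (hc₅ : 0 < c₅)
    (hρ : 0 < ρ) (hζ : 0 < ζ) (hΔ : 0 < Δ) :
    ∃ C : ℝ, 0 < C ∧ ∃ K : ℝ, 0 < K ∧ ∃ K₁ : ℝ → ℝ, (∀ c, 0 < K₁ c) ∧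
      ∀ (n : ℕ), 0 < n →
      ∀ (Ω : Type*) [MeasurableSpace Ω] (Z : Type*) [MeasurableSpace Z]
        (μ : Measure Ω) [IsProbabilityMeasure μ] (z : ℕ → Ω → Z)
        (ℓ : Z → EuclideanSpace ℝ (Fin p) → ℝ)
        (g : Z → EuclideanSpace ℝ (Fin p) → EuclideanSpace ℝ (Fin p))
        (θ₀ : Finset ℕ → EuclideanSpace ℝ (Fin p)),
      MEstConditions Θ r₀ c₁ c₂ c₃ c₄ c₅ ρ ζ Δ n μ z ℓ g θ₀ →
      ∃ A : Set Ω, MeasurableSet A ∧ 1 - (n : ℝ) ^ (-C) ≤ μ.real A ∧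
        ∀ ω ∈ A, ∀ R I : Finset ℕ, IsInterval n R → IsInterval n I → R ⊆ I →
        ∀ θR ∈ argminSet Θ (empLoss z ℓ ω R), ∀ θI ∈ argminSet Θ (empLoss z ℓ ω I),
          0 ≤ (I.card : ℝ)⁻¹ * (empLoss z ℓ ω I θR - empLoss z ℓ ω I θI) ∧
          ∀ r : ℝ, r₀ ≤ r → IsCoveredBy n r R I →
            (I.card : ℝ)⁻¹ * (empLoss z ℓ ω I θR - empLoss z ℓ ω I θI) ≤
              K * (biasSq μ z g I R (θ₀ R) + (1 - r) * (Real.log n / I.card)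
                + Real.log n ^ 2 / (I.card : ℝ) ^ 2) ∧
            ∀ c : ℝ, NearlyHomogeneous μ z n c I →
              (I.card : ℝ)⁻¹ * (empLoss z ℓ ω I θR - empLoss z ℓ ω I θI) ≤
                K₁ c * ((1 - r) * (Real.log n / I.card)
                  + Real.log n ^ 2 / (I.card : ℝ) ^ 2) := by
  -- The net exponent and the diameter must be fixed before n and the model, hence before
  -- compactness of Θ is known. For unbounded Θ the conditions are contradictory.
  by_cases hbdd : Bornology.IsBounded Θ
  swap
  · exact ⟨1, one_pos, 1, one_pos, fun _ => 1, fun _ => one_pos,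
      fun n _ Ω _ Z _ μ _ z ℓ g θ₀ h => absurd h.compact.isBounded hbdd⟩
  obtain ⟨b, hb⟩ := exists_finset_net hbdd
  obtain ⟨d, hd, hdΘ⟩ : ∃ d : ℝ, 0 ≤ d ∧ ∀ x ∈ Θ, ∀ y ∈ Θ, ‖x - y‖ ≤ d := by
    obtain ⟨d, hd⟩ := Metric.isBounded_iff.1 hbdd
    exact ⟨max d 0, le_max_right _ _, fun x hx y hy => by
      rw [← dist_eq_norm]; exact (hd hx hy).trans (le_max_left _ _)⟩
  set C := MEstConditions.deviationConst p b c₁ c₃ d with hC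
  have hC0 : 0 ≤ C := by rw [hC, MEstConditions.deviationConst]; positivity
  set K := excessConst d C ζ ρ r₀
  have hK : 0 < K := (excess_consts_pos hd hC0 hζ.le hρ hr₀).2.2.2
  -- The summand depending on c is the squared-bias bound of `biasSq_le`, absorbed into the (log
  -- n)²/|I|² term.
  refine ⟨1, one_pos, K, hK, fun c => K * (1 + (C * (1 + 2 / r₀) * c) ^ 2),
    fun c => by positivity, ?_⟩
  intro n hn Ω _ Z _ μ _ z ℓ g θ₀ h
  rw [Real.rpow_neg_one]
  -- For n = 1 the logarithm vanishes and R = I, so the excess is exactly 0 and the whole space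
  -- serves as the event.
  rcases (show n = 1 ∨ 2 ≤ n by omega) with rfl | hn2
  · refine ⟨Set.univ, MeasurableSet.univ, by simp, fun ω _ R I hR hI _ θR hθR θI hθI => ?_⟩
    obtain rfl : R = I := by
      obtain ⟨s, e, hse, he, rfl⟩ := hR
      obtain ⟨s', e', hse', he', rfl⟩ := hI
      congr 1 <;> omega
    have heq : empLoss z ℓ ω R θR - empLoss z ℓ ω R θI = 0 :=
      sub_eq_zero.2 (le_antisymm (hθR.2 _ hθI.1) (hθI.2 _ hθR.1))
    have hb0 : 0 ≤ biasSq μ z g R R (θ₀ R) := sq_nonneg _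
    rw [heq, mul_zero]
    refine ⟨le_rfl, fun r _ _ => ⟨?_, fun c _ => ?_⟩⟩
    · simpa using mul_nonneg hK.le hb0
    · simp
  choose N hNΘ hN hNcard using hb n hn2
  obtain ⟨A, hA, hμA, hcontrol⟩ := h.exists_measurableSet_empiricalControl hd hdΘ hc₁ hc₃ hρ hζ hn2
    hNΘ hN hNcard
  refine ⟨A, hA, hμA, fun ω hω R I hR hI hRI θR hθR θI hθI => ⟨?_, fun r hr hcov => ?_⟩⟩
  · exact mul_nonneg (by positivity) (sub_nonneg.2 (hθI.2 θR hθR.1))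
  have hctl := hcontrol ω hω
  have hcI : (0 : ℝ) < I.card := by exact_mod_cast hI.card_pos
  have hcov₀ : IsCoveredBy n r₀ R I :=
    ⟨hR, hI, hRI, le_trans (by gcongr) hcov.2.2.2⟩
  have hexc := hctl.excess_le_sq hr₀ hr₀'.le hR hI hRI hcov₀.2.2.2 hθR.1 hθR.2 hθI.1 hθI.2
  have hκ : ((I \ R).card : ℝ) / I.card ≤ 1 - r := by
    rw [Finset.card_sdiff_of_subset hRI, Nat.cast_sub (Finset.card_le_card hRI),
      div_le_iff₀ hcI]
    linarith [hcov.2.2.2]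
  have hlog : 0 < Real.log n := hctl.log_pos
  have hmain : (I.card : ℝ)⁻¹ * (empLoss z ℓ ω I θR - empLoss z ℓ ω I θI) ≤
      K * (biasSq μ z g I R (θ₀ R) + (1 - r) * (Real.log n / I.card)
        + Real.log n ^ 2 / (I.card : ℝ) ^ 2) := by
    refine hexc.trans ?_
    rw [biasSq, ← div_pow]
    gcongr
  refine ⟨hmain, fun c hhom => hmain.trans ?_⟩
  have hbias := h.biasSq_le hr₀ hC0 hctl.norm_mean_le hcov₀ hhom
  have hr1 : 0 ≤ (1 - r) * (Real.log n / I.card) :=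
    mul_nonneg (le_trans (by positivity) hκ) (by positivity)
  rw [mul_assoc]
  refine mul_le_mul_of_nonneg_left ?_ hK.le
  have := mul_nonneg (sq_nonneg (C * (1 + 2 / r₀) * c)) hr1
  linarith
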